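/- Let $d\ge 2$ and let $m(\mathbf x)=c+\sum_{\alpha=1}^d m_\alpha(x_\alpha)$. Let $(\mathbf X_i,\varepsilon_i)_{i\ge1}$ be a process of random vectors $\mathbf X_i=(X_{i1},\dots,X_{id})$ and real random variables $\varepsilon_i$, where the $\mathbf X_i$ share a common law and $E\,m_\alpha(X_{i\alpha})=0$ for all $\alpha$. Assume: (A1) $m_1\in C^{(2)}[0,1]$, and for some constant $C>0$, $|m_\beta(x)-m_\beta(x')|\le C|x-x'|$ for all $x,x'\in[0,1]$ and $\beta=2,\dots,d$. (A2) With $\mathbf Z_i=(\mathbf X_i,\varepsilon_i)$ and $\alpha(k)=\sup|P(B\cap C)-P(B)P(C)|$, the supremum being over all $t$, all $B\in\sigma(\mathbf Z_s,s\le t)$ and all $C\in\sigma(\mathbf Z_s,s\ge t+k)$, there are $K_0,\lambda_0>0$ such that $\alpha(k)\le K_0e^{-\lambda_0k}$ for all $k\ge1$. (A4) $\mathbf X_i$ takes values in $[0,1]^d$ and has there a continuous density $f$ with $0<c_f\le f\le C_f<\infty$; its marginal densities $f_\alpha$ are continuously differentiable on $[0,1]$ with $c_f\le f_\alpha\le C_f$.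 (A5) $K$ is Lipschitz continuous on $[-1,1]$, bounded, nonnegative, symmetric, and zero outside $[-1,1]$; the bandwidth $h=h_n$ satisfies $c_hn^{-1/5}\le h\le C_hn^{-1/5}$ for all large $n$, with constants $c_h,C_h>0$. Write $K_h(u)=K(u/h)/h$. (A6) The integer $N=N_n$ satisfies $c_Nn^{2/5}\log n\le N\le C_Nn^{2/5}\log n$ for all large $n$, with constants $c_N,C_N>0$. Put $H=(N+1)^{-1}$. Let $I_J$ be the indicator function of $[JH,(J+1)H)$ for $J=0,\dots,N$. With $\|\varphi\|_{2,\alpha}=\{E\varphi^2(X_{i\alpha})\}^{1/2}$, put $$b_{J,\alpha}=I_{J+1}-\frac{\|I_{J+1}\|_{2,\alpha}}{\|I_J\|_{2,\alpha}}I_J,\qquad B_{J,\alpha}=\frac{b_{J,\alpha}}{\|b_{J,\alpha}\|_{2,\alpha}},\qquad J=0,\dots,N-1 .$$ For each sample size $n$ let $(\tilde\lambda_0,(\tilde\lambda_{J,\alpha}))\in\mathbb R^{1+dN}$ be any minimizer of $$\sum_{i=1}^n\Big\{m(\mathbf X_i)-\lambda_0-\sum_{\alpha=1}^d\sum_{J=0}^{N-1}\lambda_{J,\alpha}B_{J,\alpha}(X_{i\alpha})\Big\}^2,$$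 and let the noiseless spline pilot fit of the $\beta$-th component be $$\tilde m_\beta(x)=\sum_{J=0}^{N-1}\tilde\lambda_{J,\beta}B_{J,\beta}(x)-\frac1n\sum_{i=1}^n\sum_{J=0}^{N-1}\tilde\lambda_{J,\beta}B_{J,\beta}(X_{i\beta}).$$ Then for every $\beta\in\{2,\dots,d\}$ (in particular for $\beta=2$) the bias part $$\Psi_b(x_1)=\frac1n\sum_{i=1}^nK_h(X_{i1}-x_1)\{\tilde m_\beta(X_{i\beta})-m_\beta(X_{i\beta})\}$$ satisfies, as $n\to\infty$, $$\sup_{x_1\in[0,1]}|\Psi_b(x_1)|=O_p(n^{-1/2}+H)\qquad\text{and}\qquad \sup_{x_1\in[0,1]}|\Psi_b(x_1)|=o_p(n^{-2/5}).$$ -/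

import Mathlib

open MeasureTheory Filter Topology

noncomputable section

namespace SPBK

/-! ### Stochastic orders -/

/-- `W n = O_p(r n)`: for each `ε > 0` there is `M` with
`P(|W n| > M * r n) ≤ ε` for all large `n`. -/
def IsBigOp {Ω : Type*} [MeasurableSpace Ω] (P : Measure Ω) (W : ℕ → Ω → ℝ) (r : ℕ → ℝ) : Prop :=
  ∀ ε : ℝ, 0 < ε → ∃ M : ℝ, 0 < M ∧
    ∀ᶠ n in atTop, P {ω | M * r n < |W n ω|} ≤ ENNReal.ofReal ε

/-- `W n = o_p(r n)`: for each `δ > 0`, `P(|W n| > δ * r n) → 0`. -/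
def IsLittleOp {Ω : Type*} [MeasurableSpace Ω] (P : Measure Ω) (W : ℕ → Ω → ℝ) (r : ℕ → ℝ) : Prop :=
  ∀ δ : ℝ, 0 < δ → Tendsto (fun n => P {ω | δ * r n < |W n ω|}) atTop (𝓝 0)

/-! ### Strong mixing -/

/-- The `α`-mixing coefficient at lag `k` of a process `Z`: the supremum of
`|P(B ∩ C) - P(B) P(C)|` over all `t`, all `B ∈ σ(Z_s, s ≤ t)` and all `C ∈ σ(Z_s, s ≥ t + k)`. -/
def mixingCoeff {Ω E : Type*} [MeasurableSpace Ω] [mE : MeasurableSpace E] (P : Measure Ω)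
    (Z : ℕ → Ω → E) (k : ℕ) : ℝ :=
  sSup {r : ℝ | ∃ (t : ℕ) (B C : Set Ω),
    MeasurableSet[⨆ s ∈ {s : ℕ | s ≤ t}, mE.comap (Z s)] B ∧
    MeasurableSet[⨆ s ∈ {s : ℕ | t + k ≤ s}, mE.comap (Z s)] C ∧
    r = |P.real (B ∩ C) - P.real B * P.real C|}

/-- Geometric `α`-mixing. -/
def GeometricallyMixing {Ω E : Type*} [MeasurableSpace Ω] [MeasurableSpace E] (P : Measure Ω)
    (Z : ℕ → Ω → E) : Prop :=
  ∃ K₀ lam₀ : ℝ, 0 < K₀ ∧ 0 < lam₀ ∧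
    ∀ k : ℕ, 1 ≤ k → mixingCoeff P Z k ≤ K₀ * Real.exp (-lam₀ * k)

/-! ### Assumptions on components, design, kernel, bandwidth and knots -/

/-- The first component (index `0`) is `C²` on `[0,1]`; all the others are Lipschitz on `[0,1]` with
a common constant. -/
def ComponentSmoothness {d : ℕ} [NeZero d] (m : Fin d → ℝ → ℝ) : Prop :=
  ContDiffOn ℝ 2 (m 0) (Set.Icc 0 1) ∧
  ∃ C : ℝ, 0 < C ∧ ∀ β : Fin d, β ≠ 0 → ∀ x ∈ Set.Icc (0 : ℝ) 1, ∀ y ∈ Set.Icc (0 : ℝ) 1,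
    |m β x - m β y| ≤ C * |x - y|

/-- Every `X i` has the same density `f` on `[0,1]^d`, continuous and bounded away from `0` and `∞`
there; its one-dimensional marginal densities are `C¹` on `[0,1]`, with the same bounds. -/
def DesignDensity {Ω : Type*} [MeasurableSpace Ω] {d : ℕ} (P : Measure Ω)
    (X : ℕ → Ω → (Fin d → ℝ)) : Prop :=
  ∃ (f : (Fin d → ℝ) → ℝ) (fm : Fin d → ℝ → ℝ) (c_f C_f : ℝ), 0 < c_f ∧
    (∀ i, P.map (X i) =
      (volume.restrict (Set.Icc (0 : Fin d → ℝ) 1)).withDensity (fun x => ENNReal.ofReal (f x))) ∧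
    ContinuousOn f (Set.Icc 0 1) ∧
    (∀ x ∈ Set.Icc (0 : Fin d → ℝ) 1, c_f ≤ f x ∧ f x ≤ C_f) ∧
    ∀ α : Fin d,
      (∀ i, P.map (fun ω => X i ω α) =
        (volume.restrict (Set.Icc (0 : ℝ) 1)).withDensity (fun t => ENNReal.ofReal (fm α t))) ∧
      ContDiffOn ℝ 1 (fm α) (Set.Icc 0 1) ∧
      ∀ t ∈ Set.Icc (0 : ℝ) 1, c_f ≤ fm α t ∧ fm α t ≤ C_f

/-- The kernel is Lipschitz on `[-1,1]`, bounded, nonnegative, symmetric and vanishes off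
`[-1,1]`. -/
def KernelCondition (K : ℝ → ℝ) : Prop :=
  (∃ C : ℝ, 0 < C ∧ ∀ u ∈ Set.Icc (-1 : ℝ) 1, ∀ v ∈ Set.Icc (-1 : ℝ) 1,
    |K u - K v| ≤ C * |u - v|) ∧
  (∃ M : ℝ, ∀ u, K u ≤ M) ∧ (∀ u, 0 ≤ K u) ∧ (∀ u, K (-u) = K u) ∧ (∀ u, 1 < |u| → K u = 0)

/-- The bandwidth `h n` is of exact order `n^(-1/5)`. -/
def BandwidthOrder (h : ℕ → ℝ) : Prop :=
  ∃ c_h C_h : ℝ, 0 < c_h ∧ 0 < C_h ∧ ∀ᶠ n : ℕ in atTop,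
    c_h * (n : ℝ) ^ (-(1 / 5) : ℝ) ≤ h n ∧ h n ≤ C_h * (n : ℝ) ^ (-(1 / 5) : ℝ)

/-- The number of interior knots `N n` is of exact order `n^(2/5) log n`. -/
def KnotOrder (N : ℕ → ℕ) : Prop :=
  ∃ c_N C_N : ℝ, 0 < c_N ∧ 0 < C_N ∧ ∀ᶠ n : ℕ in atTop,
    c_N * ((n : ℝ) ^ (2 / 5 : ℝ) * Real.log n) ≤ N n ∧
    (N n : ℝ) ≤ C_N * ((n : ℝ) ^ (2 / 5 : ℝ) * Real.log n)

/-! ### The constant spline basis -/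

/-- The length `H = 1 / (N + 1)` of the subintervals. -/
def mesh (N : ℕ) : ℝ := 1 / ((N : ℝ) + 1)

/-- The indicator `I_J` of `[J H, (J + 1) H)`, for `J = 0, …, N`. -/
def stepFn (N J : ℕ) (x : ℝ) : ℝ :=
  (Set.Ico ((J : ℝ) * mesh N) (((J : ℝ) + 1) * mesh N)).indicator (fun _ => (1 : ℝ)) x

/-- The theoretical norm `‖φ‖₂ = (E φ(ξ)²)^(1/2)` where `ξ` has law `μ`. -/
def l2Norm (μ : Measure ℝ) (φ : ℝ → ℝ) : ℝ := Real.sqrt (∫ x, φ x ^ 2 ∂μ)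

/-- `b_J = I_{J+1} - (‖I_{J+1}‖₂ / ‖I_J‖₂) I_J`, for `J = 0, …, N - 1`. -/
def splineb (μ : Measure ℝ) (N J : ℕ) (x : ℝ) : ℝ :=
  stepFn N (J + 1) x - l2Norm μ (stepFn N (J + 1)) / l2Norm μ (stepFn N J) * stepFn N J x

/-- `B_J = b_J / ‖b_J‖₂`. -/
def splineB (μ : Measure ℝ) (N J : ℕ) (x : ℝ) : ℝ :=
  splineb μ N J x / l2Norm μ (splineb μ N J)

/-! ### The spline fit and its components -/

/-- Coefficients `(λ₀, (λ_{J,α}))` in `ℝ^(1 + d N)`. -/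
abbrev SplineCoeff (d N : ℕ) : Type := ℝ × (Fin d → Fin N → ℝ)

/-- The uncentered component `∑_J λ_{J,α} B_{J,α}` at `t`; `μ α` is the law of the `α`-th
predictor. -/
def splineComponent {d N : ℕ} (μ : Fin d → Measure ℝ) (a : SplineCoeff d N) (α : Fin d) (t : ℝ) :
    ℝ :=
  ∑ J : Fin N, a.2 α J * splineB (μ α) N (J : ℕ) t

/-- The additive spline `λ₀ + ∑_α ∑_J λ_{J,α} B_{J,α}(x_α)`. -/
def additiveSpline {d N : ℕ} (μ : Fin d → Measure ℝ) (a : SplineCoeff d N) (x : Fin d → ℝ) : ℝ :=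
  a.1 + ∑ α : Fin d, splineComponent μ a α (x α)

/-- `a` solves the least squares problem for the responses `y i` at the design points `x i`,
`i < n`. -/
def IsLeastSquares {d N : ℕ} (μ : Fin d → Measure ℝ) (n : ℕ) (x : ℕ → Fin d → ℝ) (y : ℕ → ℝ)
    (a : SplineCoeff d N) : Prop :=
  ∀ b : SplineCoeff d N,
    ∑ i ∈ Finset.range n, (y i - additiveSpline μ a (x i)) ^ 2 ≤
      ∑ i ∈ Finset.range n, (y i - additiveSpline μ b (x i)) ^ 2

/-- The empirically centered `α`-th component of the fit with coefficients `a`. -/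
def pilotComponent {d N : ℕ} (μ : Fin d → Measure ℝ) (n : ℕ) (x : ℕ → Fin d → ℝ)
    (a : SplineCoeff d N) (α : Fin d) (t : ℝ) : ℝ :=
  splineComponent μ a α t - (n : ℝ)⁻¹ * ∑ i ∈ Finset.range n, splineComponent μ a α (x i α)

/-- The additive regression function `m(x) = c + ∑_α m_α(x_α)`. -/
def additiveMean {d : ℕ} (c : ℝ) (m : Fin d → ℝ → ℝ) (x : Fin d → ℝ) : ℝ :=
  c + ∑ α : Fin d, m α (x α)

/-- `K_h(u) = K(u / h) / h`. -/
def scaledKernel (K : ℝ → ℝ) (h u : ℝ) : ℝ := K (u / h) / h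

/-- The bias part
`n⁻¹ ∑_i K_h(X_{i1} - x₁) {m̃_β(X_{iβ}) - m_β(X_{iβ})}` for the fit with coefficients `a`
(the first predictor has index `0`). -/
def biasPart {d N : ℕ} [NeZero d] (K : ℝ → ℝ) (h : ℝ) (m : Fin d → ℝ → ℝ) (μ : Fin d → Measure ℝ)
    (n : ℕ) (x : ℕ → Fin d → ℝ) (a : SplineCoeff d N) (β : Fin d) (x₁ : ℝ) : ℝ :=
  (n : ℝ)⁻¹ * ∑ i ∈ Finset.range n,
    scaledKernel K h (x i 0 - x₁) * (pilotComponent μ n x a β (x i β) - m β (x i β))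

end SPBK

end

/-!
Subtracting from the least squares fit the step functions that interpolate the `m_α` at the left
knots leaves an additive step function `g` whose empirical norm is at most `2 d l H`, where `l` is
the Lipschitz constant. Geometric mixing makes the empirical frequencies of the `O(N²)` cells of all
pairs of predictors concentrate jointly: the indicators of disjoint cells have total variance
`O(N^(2θ) / n)` for every `θ > 0`. On such samples the empirical norm of an additive step function
dominates its norm under the uniform law on the cube. There the recentred components of `g` are
orthogonal, so the heights of each component have square sum `O(H)`.

The kernel average of the `β`-th component of `g` pairs these heights with the kernel weights of the
slabs of the `β`-th predictor. These weights have square sum `O(H)` uniformly in `x₁`, because a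
window of width `h` meets few cells and each of them has about its theoretical frequency. By
Cauchy–Schwarz the average is `O(H)`, without a supremum bound on the fit and without a union bound
over `x₁`. The empirical centring of the pilot fit costs a further `O_p(n^{-1/2})`, by summation by
parts over the tails of the `β`-th predictor. Since `N` has exact order `n^(2/5) log n`, the
resulting rate `n^{-1/2} + H` is `o(n^{-2/5})`.
-/

noncomputable section

namespace SPBK

/-! ### Empirical measures -/

section Empirical

variable {E : Type*} [MeasurableSpace E]

/-- The empirical measure of the first `n` terms of `x`; it is `0` for `n = 0`. -/
def empirical (n : ℕ) (x : ℕ → E) : Measure E :=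
  (n : NNReal)⁻¹ • ∑ i ∈ Finset.range n, Measure.dirac (x i)

instance (n : ℕ) (x : ℕ → E) : IsFiniteMeasure (empirical n x) := by
  unfold empirical
  infer_instance

theorem real_empirical (n : ℕ) (x : ℕ → E) {A : Set E} (hA : MeasurableSet A) :
    (empirical n x).real A =
      (n : ℝ)⁻¹ * ∑ i ∈ Finset.range n, A.indicator (fun _ => (1 : ℝ)) (x i) := by
  rw [empirical, measureReal_nnreal_smul_apply, NNReal.coe_inv, NNReal.coe_natCast,
    measureReal_def, Measure.finsetSum_apply, ENNReal.toReal_sum fun _ _ => measure_ne_top _ _]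
  congr 1
  refine Finset.sum_congr rfl fun i _ => ?_
  by_cases hi : x i ∈ A <;> simp [hA, hi]

theorem isProbabilityMeasure_empirical {n : ℕ} (hn : 0 < n) (x : ℕ → E) :
    IsProbabilityMeasure (empirical n x) := by
  have hn' : (n : ℝ) ≠ 0 := by positivity
  refine isProbabilityMeasure_iff_real.2 ?_
  simp [real_empirical, hn']

theorem ae_empirical (n : ℕ) {x : ℕ → E} {p : E → Prop} (hp : MeasurableSet {y | p y})
    (hx : ∀ i, p (x i)) : ∀ᵐ y ∂empirical n x, p y := by
  refine Measure.ae_smul_measure ?_ _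
  rw [ae_finsetSum_measure_iff]
  exact fun i _ => (ae_dirac_iff hp).2 (hx i)

variable [MeasurableSingletonClass E]

theorem integrable_empirical (n : ℕ) (x : ℕ → E) (f : E → ℝ) :
    Integrable f (empirical n x) :=
  (integrable_finsetSum_measure.2 fun i _ => integrable_dirac (by simp)).smul_measure_nnreal

theorem integral_empirical (n : ℕ) (x : ℕ → E) (f : E → ℝ) :
    ∫ y, f y ∂empirical n x = (n : ℝ)⁻¹ * ∑ i ∈ Finset.range n, f (x i) := by
  rw [empirical, integral_smul_nnreal_measure,
    integral_finsetSum_measure fun i _ => integrable_dirac (by simp)]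
  simp [NNReal.smul_def]

end Empirical

/-! ### Empirical frequencies under mixing -/

section Mixing

variable {Ω E : Type*} [MeasurableSpace Ω] [MeasurableSpace E] (P : Measure Ω)

/-- The dependence between the occurrences of a fixed event at two times decays geometrically in
their distance. Since equal times are included, `K` has to absorb the variances. -/
structure GeometricEventDecay (X : ℕ → Ω → E) (K r : ℝ) : Prop where
  const_pos : 0 < K
  rate_pos : 0 < r
  rate_lt_one : r < 1
  abs_sub_le : ∀ A : Set E, MeasurableSet A → ∀ i j,
    |P.real (X i ⁻¹' A ∩ X j ⁻¹' A) - P.real (X i ⁻¹' A) * P.real (X j ⁻¹' A)| ≤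
      K * r ^ Nat.dist i j

variable {P} in
theorem real_preimage_eq {X : ℕ → Ω → E} {π : Measure E} (hX : ∀ i, Measurable (X i))
    (hlaw : ∀ i, P.map (X i) = π) {A : Set E} (hA : MeasurableSet A) (i : ℕ) :
    P.real (X i ⁻¹' A) = π.real A := by
  rw [← hlaw i, map_measureReal_apply (hX i) hA]

variable [IsProbabilityMeasure P]

theorem abs_real_inter_sub_mul_le_one (B C : Set Ω) :
    |P.real (B ∩ C) - P.real B * P.real C| ≤ 1 :=
  abs_sub_le_of_nonneg_of_le measureReal_nonneg measureReal_le_one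
    (mul_nonneg measureReal_nonneg measureReal_nonneg)
    (mul_le_one₀ measureReal_le_one measureReal_nonneg measureReal_le_one)

theorem abs_real_inter_sub_mul_le_mixingCoeff (Z : ℕ → Ω → E) {B C : Set E}
    (hB : MeasurableSet B) (hC : MeasurableSet C) (i k : ℕ) :
    |P.real (Z i ⁻¹' B ∩ Z (i + k) ⁻¹' C) - P.real (Z i ⁻¹' B) * P.real (Z (i + k) ⁻¹' C)| ≤
      mixingCoeff P Z k := by
  refine le_csSup ⟨1, ?_⟩ ⟨i, Z i ⁻¹' B, Z (i + k) ⁻¹' C, ?_, ?_, rfl⟩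
  · rintro _ ⟨t, B, C, -, -, rfl⟩
    exact abs_real_inter_sub_mul_le_one P B C
  · have : MeasurableSpace.comap (Z i) inferInstance ≤
        ⨆ s ∈ {s : ℕ | s ≤ i}, MeasurableSpace.comap (Z s) inferInstance :=
      le_iSup₂_of_le i (Nat.le_refl i) le_rfl
    exact this _ ⟨B, hB, rfl⟩
  · have : MeasurableSpace.comap (Z (i + k)) inferInstance ≤
        ⨆ s ∈ {s : ℕ | i + k ≤ s}, MeasurableSpace.comap (Z s) inferInstance :=
      le_iSup₂_of_le (i + k) (Nat.le_refl _) le_rfl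
    exact this _ ⟨C, hC, rfl⟩

variable {P}

theorem GeometricallyMixing.geometricEventDecay_fst {F : Type*} [MeasurableSpace F]
    {X : ℕ → Ω → E} {Y : ℕ → Ω → F} (hmix : GeometricallyMixing P fun i ω => (X i ω, Y i ω)) :
    ∃ K r, GeometricEventDecay P X K r := by
  obtain ⟨K₀, lam, hK, hlam, hdec⟩ := hmix
  refine ⟨1 + K₀, Real.exp (-lam), by positivity, Real.exp_pos _, by simpa, fun A hA i j => ?_⟩
  wlog hij : i ≤ j generalizing i j
  · rw [Set.inter_comm, mul_comm (P.real _), Nat.dist_comm]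
    exact this j i (le_of_not_ge hij)
  obtain ⟨k, rfl⟩ := Nat.exists_eq_add_of_le hij
  have hexp : Real.exp (-lam * k) = Real.exp (-lam) ^ Nat.dist i (i + k) := by
    rw [Nat.dist_eq_sub_of_le hij, Nat.add_sub_cancel_left, ← Real.exp_nat_mul, mul_comm]
  rw [← hexp, add_mul, one_mul]
  rcases Nat.eq_zero_or_pos k with rfl | hk
  · have := abs_real_inter_sub_mul_le_one P (X i ⁻¹' A) (X (i + 0) ⁻¹' A)
    simp only [Nat.cast_zero, mul_zero, Real.exp_zero, mul_one]
    linarith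
  · have h := abs_real_inter_sub_mul_le_mixingCoeff P (fun i ω => (X i ω, Y i ω))
      (hA.prod MeasurableSet.univ) (hA.prod MeasurableSet.univ) i k
    have hpre : ∀ j, (fun ω => (X j ω, Y j ω)) ⁻¹' (A ×ˢ (Set.univ : Set F)) = X j ⁻¹' A := by
      intro j
      ext
      simp
    rw [hpre, hpre] at h
    linarith [hdec k hk, Real.exp_pos (-lam * k)]

theorem covariance_indicator_one {B C : Set Ω} (hB : MeasurableSet B) (hC : MeasurableSet C) :
    ProbabilityTheory.covariance (B.indicator fun _ => (1 : ℝ)) (C.indicator fun _ => 1) P =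
      P.real (B ∩ C) - P.real B * P.real C := by
  have hmem : ∀ {D : Set Ω}, MeasurableSet D → MemLp (D.indicator fun _ => (1 : ℝ)) 2 P :=
    fun hD => (memLp_const 1).indicator hD
  have hint : ∀ {D : Set Ω}, MeasurableSet D →
      ∫ ω, D.indicator (fun _ => (1 : ℝ)) ω ∂P = P.real D := fun hD => by
    rw [integral_indicator_const _ hD, smul_eq_mul, mul_one]
  rw [ProbabilityTheory.covariance_eq_sub (hmem hB) (hmem hC), hint hB, hint hC,
    ← hint (hB.inter hC)]
  congr 2
  ext ω
  by_cases hB : ω ∈ B <;> by_cases hC : ω ∈ C <;> simp [hB, hC]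

variable {X : ℕ → Ω → E} {A : Set E}

theorem memLp_real_empirical (hX : ∀ i, Measurable (X i)) (hA : MeasurableSet A) (n : ℕ) :
    MemLp (fun ω => (empirical n (X · ω)).real A) 2 P := by
  simp only [real_empirical n _ hA]
  exact (memLp_finsetSum _ fun i _ =>
    (memLp_const (1 : ℝ)).indicator (hX i hA)).const_mul _

theorem variance_real_empirical (hX : ∀ i, Measurable (X i)) (hA : MeasurableSet A) (n : ℕ) :
    ProbabilityTheory.variance (fun ω => (empirical n (X · ω)).real A) P =
      (n : ℝ)⁻¹ ^ 2 * ∑ i ∈ Finset.range n, ∑ j ∈ Finset.range n,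
        (P.real (X i ⁻¹' A ∩ X j ⁻¹' A) - P.real (X i ⁻¹' A) * P.real (X j ⁻¹' A)) := by
  simp only [real_empirical n _ hA]
  rw [ProbabilityTheory.variance_const_mul]
  congr 1
  refine (ProbabilityTheory.variance_fun_sum' fun i _ =>
    (memLp_const (1 : ℝ)).indicator (hX i hA)).trans ?_
  exact Finset.sum_congr rfl fun i _ => Finset.sum_congr rfl fun j _ =>
    covariance_indicator_one (hX i hA) (hX j hA)

variable {π : Measure E} {n : ℕ}

theorem integral_real_empirical (hX : ∀ i, Measurable (X i)) (hlaw : ∀ i, P.map (X i) = π)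
    (hA : MeasurableSet A) (hn : 0 < n) :
    ∫ ω, (empirical n (X · ω)).real A ∂P = π.real A := by
  have hmean : ∀ i, ∫ ω, A.indicator (fun _ => (1 : ℝ)) (X i ω) ∂P = π.real A := fun i => by
    rw [← real_preimage_eq hX hlaw hA i]
    exact (integral_indicator_const _ (hX i hA)).trans (by simp)
  have hn' : (n : ℝ) ≠ 0 := by positivity
  have hint : ∀ i, Integrable (fun ω => A.indicator (fun _ => (1 : ℝ)) (X i ω)) P := fun i =>
    (integrable_const (1 : ℝ)).indicator (hX i hA)
  simp only [real_empirical n _ hA]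
  rw [integral_const_mul, integral_finsetSum _ fun i _ => hint i]
  simp [hmean, hn']

end Mixing

section SqError

variable {E ι : Type*} [MeasurableSpace E]

/-- The squared Euclidean distance of the vectors that `ν` and `π` assign to the cells `A c`,
`c ∈ s`. -/
def sqError (ν π : Measure E) (s : Finset ι) (A : ι → Set E) : ℝ :=
  ∑ c ∈ s, (ν.real (A c) - π.real (A c)) ^ 2

theorem sum_pow_dist_le {q : ℝ} (hq0 : 0 ≤ q) (hq1 : q < 1) (i n : ℕ) :
    ∑ j ∈ Finset.range n, q ^ Nat.dist i j ≤ 2 / (1 - q) := by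
  have hgeom : ∀ k, ∑ j ∈ Finset.range k, q ^ j ≤ (1 - q)⁻¹ := fun k => by
    rw [← tsum_geometric_of_lt_one hq0 hq1]
    exact (summable_geometric_of_lt_one hq0 hq1).sum_le_tsum _ fun j _ => pow_nonneg hq0 j
  calc ∑ j ∈ Finset.range n, q ^ Nat.dist i j
      ≤ ∑ j ∈ Finset.range (i + 1 + n), q ^ Nat.dist i j :=
        Finset.sum_le_sum_of_subset_of_nonneg (Finset.range_subset_range.2 (by omega))
          fun j _ _ => pow_nonneg hq0 _
    _ = ∑ j ∈ Finset.range (i + 1), q ^ j + ∑ j ∈ Finset.range n, q ^ (j + 1) := by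
        rw [Finset.sum_range_add, ← Finset.sum_range_reflect]
        congr 1 <;> refine Finset.sum_congr rfl fun j hj => ?_ <;>
          rw [Finset.mem_range] at hj <;> congr 1 <;> unfold Nat.dist <;> omega
    _ ≤ ∑ j ∈ Finset.range (i + 1), q ^ j + ∑ j ∈ Finset.range n, q ^ j := by
        refine add_le_add le_rfl (Finset.sum_le_sum fun j _ => ?_)
        exact pow_le_pow_of_le_one hq0 hq1.le j.le_succ
    _ ≤ 2 / (1 - q) := by
        rw [div_eq_mul_inv, two_mul]
        exact add_le_add (hgeom _) (hgeom _)

theorem le_rpow_of_le_one_of_le {a y θ : ℝ} (hy : 0 ≤ y) (hθ0 : 0 ≤ θ) (hθ1 : θ ≤ 1)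
    (ha : a ≤ 1) (hay : a ≤ y) : a ≤ y ^ θ := by
  rcases le_total y 1 with h | h
  · simpa using hay.trans
      (y.rpow_one.ge.trans (Real.rpow_le_rpow_of_exponent_ge' hy h hθ0 hθ1))
  · exact ha.trans (Real.one_le_rpow h hθ0)

/-- The constant of the total mean square error of cell frequencies, interpolated with exponent
`θ`. -/
def mixConst (K r θ : ℝ) : ℝ := 2 * K ^ θ / (1 - r ^ θ)

variable {Ω : Type*} [MeasurableSpace Ω] {P : Measure Ω} [IsProbabilityMeasure P]
  {X : ℕ → Ω → E} {K r : ℝ} {π : Measure E} {A : ι → Set E} {s : Finset ι}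

theorem sum_real_inter_le_one (hX : ∀ i, Measurable (X i)) (hA : ∀ c, MeasurableSet (A c))
    (hdisj : (s : Set ι).PairwiseDisjoint A) (i j : ℕ) :
    ∑ c ∈ s, P.real (X i ⁻¹' A c ∩ X j ⁻¹' A c) ≤ 1 := by
  rw [← measureReal_biUnion_finset _ fun c _ => (hX i (hA c)).inter (hX j (hA c))]
  · exact measureReal_le_one
  · exact fun a ha b hb hab => ((hdisj ha hb hab).preimage (X i)).mono
      Set.inter_subset_left Set.inter_subset_left

/-- The disjointness of the cells gives the bound `1`, the decay of each covariance the bound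
`card s * K * r ^ |i - j|`; interpolating keeps both a small power of `card s` and summability. -/
theorem GeometricEventDecay.sum_real_inter_sub_le (hdec : GeometricEventDecay P X K r)
    (hX : ∀ i, Measurable (X i)) (hA : ∀ c, MeasurableSet (A c))
    (hdisj : (s : Set ι).PairwiseDisjoint A) {θ : ℝ} (hθ0 : 0 ≤ θ) (hθ1 : θ ≤ 1) (i j : ℕ) :
    ∑ c ∈ s, (P.real (X i ⁻¹' A c ∩ X j ⁻¹' A c) -
        P.real (X i ⁻¹' A c) * P.real (X j ⁻¹' A c)) ≤
      (s.card : ℝ) ^ θ * K ^ θ * (r ^ θ) ^ Nat.dist i j := by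
  have hK := hdec.const_pos
  have hr := hdec.rate_pos
  have hpow : (s.card : ℝ) ^ θ * K ^ θ * (r ^ θ) ^ Nat.dist i j =
      (s.card * (K * r ^ Nat.dist i j)) ^ θ := by
    rw [Real.mul_rpow (by positivity) (by positivity), Real.mul_rpow hK.le (by positivity),
      Real.rpow_pow_comm hr.le, mul_assoc]
  rw [hpow]
  refine le_rpow_of_le_one_of_le (by positivity) hθ0 hθ1 ?_ ?_
  · refine (Finset.sum_le_sum fun c _ => ?_).trans (sum_real_inter_le_one (P := P) hX hA hdisj i j)
    exact sub_le_self _ (mul_nonneg measureReal_nonneg measureReal_nonneg)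
  · rw [← nsmul_eq_mul]
    exact Finset.sum_le_card_nsmul _ _ _ fun c _ =>
      (le_abs_self _).trans (hdec.abs_sub_le (A c) (hA c) i j)

theorem integrable_sq_real_empirical_sub (hX : ∀ i, Measurable (X i)) {B : Set E}
    (hB : MeasurableSet B) (n : ℕ) :
    Integrable (fun ω => ((empirical n (X · ω)).real B - π.real B) ^ 2) P :=
  ((memLp_real_empirical hX hB n).sub (memLp_const _)).integrable_sq

theorem GeometricEventDecay.integral_sqError_le (hdec : GeometricEventDecay P X K r)
    (hX : ∀ i, Measurable (X i)) (hlaw : ∀ i, P.map (X i) = π) (hA : ∀ c, MeasurableSet (A c))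
    (hdisj : (s : Set ι).PairwiseDisjoint A) {θ : ℝ} (hθ0 : 0 < θ) (hθ1 : θ ≤ 1) {n : ℕ}
    (hn : 0 < n) :
    ∫ ω, sqError (empirical n (X · ω)) π s A ∂P ≤ mixConst K r θ * (s.card : ℝ) ^ θ / n := by
  have hvar : ∀ c, ∫ ω, ((empirical n (X · ω)).real (A c) - π.real (A c)) ^ 2 ∂P =
      ProbabilityTheory.variance (fun ω => (empirical n (X · ω)).real (A c)) P := fun c => by
    rw [ProbabilityTheory.variance_eq_integral
      (memLp_real_empirical hX (hA c) n).aestronglyMeasurable.aemeasurable,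
      integral_real_empirical hX hlaw (hA c) hn]
  have hn' : (n : ℝ) ≠ 0 := by positivity
  have hK := hdec.const_pos
  calc ∫ ω, sqError (empirical n (X · ω)) π s A ∂P
      = (n : ℝ)⁻¹ ^ 2 * ∑ i ∈ Finset.range n, ∑ j ∈ Finset.range n, ∑ c ∈ s,
          (P.real (X i ⁻¹' A c ∩ X j ⁻¹' A c) -
            P.real (X i ⁻¹' A c) * P.real (X j ⁻¹' A c)) := by
        unfold sqError
        rw [integral_finsetSum _ fun c _ => integrable_sq_real_empirical_sub hX (hA c) n,
          Finset.sum_congr rfl fun i _ => Finset.sum_comm, Finset.sum_comm, Finset.mul_sum]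
        exact Finset.sum_congr rfl fun c _ =>
          (hvar c).trans (variance_real_empirical hX (hA c) n)
    _ ≤ (n : ℝ)⁻¹ ^ 2 * ∑ i ∈ Finset.range n, ∑ j ∈ Finset.range n,
          (s.card : ℝ) ^ θ * K ^ θ * (r ^ θ) ^ Nat.dist i j := by
        gcongr with i _ j _
        exact hdec.sum_real_inter_sub_le hX hA hdisj hθ0.le hθ1 i j
    _ ≤ (n : ℝ)⁻¹ ^ 2 * ∑ i ∈ Finset.range n, (s.card : ℝ) ^ θ * K ^ θ * (2 / (1 - r ^ θ)) := by
        gcongr with i _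
        rw [← Finset.mul_sum]
        gcongr
        exact sum_pow_dist_le (Real.rpow_nonneg hdec.rate_pos.le _)
          (Real.rpow_lt_one hdec.rate_pos.le hdec.rate_lt_one hθ0) i n
    _ = mixConst K r θ * (s.card : ℝ) ^ θ / n := by
        rw [Finset.sum_const, Finset.card_range, nsmul_eq_mul, mixConst]
        field_simp

theorem GeometricEventDecay.measure_lt_sum_sqError_le (hdec : GeometricEventDecay P X K r)
    (hX : ∀ i, Measurable (X i)) (hlaw : ∀ i, P.map (X i) = π) {κ : Type*} {t : Finset κ}
    {A : κ → ι → Set E} (hA : ∀ k c, MeasurableSet (A k c))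
    (hdisj : ∀ k, (s : Set ι).PairwiseDisjoint (A k)) {θ : ℝ} (hθ0 : 0 < θ) (hθ1 : θ ≤ 1) {n : ℕ}
    (hn : 0 < n) {δ : ℝ} (hδ : 0 < δ) :
    P {ω | δ < ∑ k ∈ t, sqError (empirical n (X · ω)) π s (A k)} ≤
      ENNReal.ofReal (t.card * (mixConst K r θ * (s.card : ℝ) ^ θ / n) / δ) := by
  set W : Ω → ℝ := fun ω => ∑ k ∈ t, sqError (empirical n (X · ω)) π s (A k)
  have hint : ∀ k ∈ t, Integrable (fun ω => sqError (empirical n (X · ω)) π s (A k)) P := fun k _ =>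
    integrable_finsetSum s fun c _ => integrable_sq_real_empirical_sub hX (hA k c) n
  have hmean : ∫ ω, W ω ∂P ≤ t.card * (mixConst K r θ * (s.card : ℝ) ^ θ / n) := by
    rw [integral_finsetSum t hint, ← nsmul_eq_mul]
    exact Finset.sum_le_card_nsmul t _ _ fun k _ =>
      hdec.integral_sqError_le hX hlaw (hA k) (hdisj k) hθ0 hθ1 hn
  have hmarkov := mul_meas_ge_le_integral_of_nonneg (μ := P) (f := W)
    (Eventually.of_forall fun ω => Finset.sum_nonneg fun k _ => Finset.sum_nonneg fun c _ =>
      sq_nonneg _) (integrable_finsetSum t hint) δ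
  refine (ENNReal.le_ofReal_iff_toReal_le (measure_ne_top _ _) ?_).2 ((le_div_iff₀' hδ).2 ?_)
  · exact div_nonneg ((integral_nonneg fun ω => Finset.sum_nonneg fun k _ =>
      Finset.sum_nonneg fun c _ => sq_nonneg _).trans hmean) hδ.le
  calc δ * P.real {ω | δ < W ω} ≤ δ * P.real {ω | δ ≤ W ω} :=
        mul_le_mul_of_nonneg_left (measureReal_mono fun ω (hω : δ < W ω) => hω.le) hδ.le
    _ ≤ t.card * (mixConst K r θ * (s.card : ℝ) ^ θ / n) := hmarkov.trans hmean

end SqError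

/-! ### Grids and the uniform law -/

section Grid

/-- The index of the interval `[J δ, (J + 1) δ)` that contains `t`. The floor is that of `ℕ`, so the
index is `0` for `t < 0`. -/
def gridIdx (δ t : ℝ) : ℕ := ⌊t / δ⌋₊

theorem gridIdx_eq_iff {δ t : ℝ} (hδ : 0 < δ) (ht : 0 ≤ t) (J : ℕ) :
    gridIdx δ t = J ↔ t ∈ Set.Ico ((J : ℝ) * δ) (((J : ℝ) + 1) * δ) := by
  rw [gridIdx, Nat.floor_eq_iff (by positivity), Set.mem_Ico, le_div_iff₀ hδ, div_lt_iff₀ hδ]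

theorem measurable_gridIdx (δ : ℝ) : Measurable (gridIdx δ) :=
  Nat.measurable_floor.comp (measurable_id.div_const δ)

theorem mesh_pos (N : ℕ) : 0 < mesh N := by
  unfold mesh
  positivity

theorem succ_mul_mesh (N : ℕ) : ((N : ℝ) + 1) * mesh N = 1 := by
  unfold mesh
  field_simp

theorem gridIdx_mesh_mem_range (N : ℕ) {t : ℝ} (ht : t ∈ Set.Ico (0 : ℝ) 1) :
    gridIdx (mesh N) t ∈ Finset.range (N + 1) := by
  rw [Finset.mem_range, gridIdx, Nat.floor_lt (div_nonneg ht.1 (mesh_pos N).le),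
    div_lt_iff₀ (mesh_pos N), Nat.cast_succ, succ_mul_mesh]
  exact ht.2

variable {E ι : Type*} [MeasurableSpace E] [MeasurableSpace ι] [MeasurableSingletonClass ι]
  [Countable ι]

theorem integrable_comp_of_ae_mem {ν : Measure E} [IsFiniteMeasure ν] {idx : E → ι}
    (hidx : Measurable idx) {s : Finset ι} (hs : ∀ᵐ y ∂ν, idx y ∈ s) (φ : ι → ℝ) :
    Integrable (fun y => φ (idx y)) ν := by
  refine Integrable.of_bound ((Measurable.of_discrete (f := φ)).comp
    hidx).aestronglyMeasurable (∑ c ∈ s, |φ c|) ?_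
  filter_upwards [hs] with y hy
  exact Finset.single_le_sum (f := fun c => |φ c|) (fun _ _ => abs_nonneg _) hy

theorem integral_comp_eq_sum {ν : Measure E} [IsFiniteMeasure ν] {idx : E → ι}
    (hidx : Measurable idx) {s : Finset ι} (hs : ∀ᵐ y ∂ν, idx y ∈ s) (φ : ι → ℝ) :
    ∫ y, φ (idx y) ∂ν = ∑ c ∈ s, φ c * ν.real (idx ⁻¹' {c}) := by
  have hφ : Measurable φ := Measurable.of_discrete
  have hmem : ∀ᵐ c ∂ν.map idx, c ∈ (s : Set ι) :=
    (ae_map_iff hidx.aemeasurable s.measurableSet).2 hs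
  rw [← integral_map hidx.aemeasurable hφ.aestronglyMeasurable,
    ← Measure.restrict_eq_self_of_ae_mem hmem, setIntegral_finset]
  · refine Finset.sum_congr rfl fun c _ => ?_
    rw [map_measureReal_apply hidx (measurableSet_singleton c), smul_eq_mul, mul_comm]
  · rw [IntegrableOn, Measure.restrict_eq_self_of_ae_mem hmem]
    exact (integrable_map_measure hφ.aestronglyMeasurable hidx.aemeasurable).2
      (integrable_comp_of_ae_mem hidx hs φ)

end Grid

section Uniform

/-- The uniform law on the unit interval. -/
def unitMeasure : Measure ℝ := volume.restrict (Set.Icc 0 1)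

instance : IsProbabilityMeasure unitMeasure := ⟨by simp [unitMeasure]⟩

/-- The uniform law on the unit cube. -/
def cubeMeasure (d : ℕ) : Measure (Fin d → ℝ) := Measure.pi fun _ => unitMeasure

instance (d : ℕ) : IsProbabilityMeasure (cubeMeasure d) := by
  unfold cubeMeasure
  infer_instance

theorem volume_restrict_Icc_eq_cubeMeasure (d : ℕ) :
    (volume : Measure (Fin d → ℝ)).restrict (Set.Icc 0 1) = cubeMeasure d := by
  unfold cubeMeasure unitMeasure
  rw [← Measure.restrict_pi_pi, ← volume_pi]
  congr 1
  exact (Set.pi_univ_Icc _ _).symm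

/-- The half-open unit cube, on which the grid indices of the coordinates are in range. -/
def unitCube (d : ℕ) : Set (Fin d → ℝ) := {x | ∀ α, x α ∈ Set.Ico (0 : ℝ) 1}

theorem measurableSet_unitCube (d : ℕ) : MeasurableSet (unitCube d) :=
  measurableSet_setOfPred.2 <| Measurable.forall fun α =>
    measurableSet_setOfPred.1 (measurable_pi_apply α measurableSet_Ico)

theorem ae_unitMeasure_mem_Ico : ∀ᵐ t ∂unitMeasure, t ∈ Set.Ico (0 : ℝ) 1 := by
  unfold unitMeasure
  rw [← Measure.restrict_congr_set Ico_ae_eq_Icc]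
  exact ae_restrict_mem measurableSet_Ico

theorem measurePreserving_eval_cubeMeasure {d : ℕ} (α : Fin d) :
    MeasurePreserving (Function.eval α) (cubeMeasure d) unitMeasure :=
  measurePreserving_eval (fun _ : Fin d => unitMeasure) α

theorem ae_cubeMeasure_mem_unitCube (d : ℕ) : ∀ᵐ x ∂cubeMeasure d, x ∈ unitCube d :=
  ae_all_iff.2 fun α =>
    (measurePreserving_eval_cubeMeasure α).quasiMeasurePreserving.ae ae_unitMeasure_mem_Ico

theorem unitMeasure_gridIdx_preimage {δ : ℝ} (hδ : 0 < δ) (J : ℕ) :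
    unitMeasure (gridIdx δ ⁻¹' {J}) =
      unitMeasure (Set.Ico ((J : ℝ) * δ) (((J : ℝ) + 1) * δ)) := by
  refine measure_congr ?_
  filter_upwards [ae_unitMeasure_mem_Ico] with t ht
  exact propext (gridIdx_eq_iff hδ ht.1 J)

theorem unitMeasure_real_gridIdx_le {δ : ℝ} (hδ : 0 < δ) (J : ℕ) :
    unitMeasure.real (gridIdx δ ⁻¹' {J}) ≤ δ := by
  refine ENNReal.toReal_le_of_le_ofReal hδ.le ?_
  rw [unitMeasure_gridIdx_preimage hδ]
  refine (Measure.restrict_apply_le _ _).trans (le_of_eq ?_)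
  rw [Real.volume_Ico]
  ring_nf

theorem unitMeasure_real_gridIdx_mesh {N J : ℕ} (hJ : J ∈ Finset.range (N + 1)) :
    unitMeasure.real (gridIdx (mesh N) ⁻¹' {J}) = mesh N := by
  have hH := mesh_pos N
  have hJN : ((J : ℝ) + 1) ≤ N + 1 := by exact_mod_cast Finset.mem_range.1 hJ
  have hsub : Set.Ico ((J : ℝ) * mesh N) (((J : ℝ) + 1) * mesh N) ⊆ Set.Icc 0 1 :=
    (Set.Ico_subset_Icc_self).trans (Set.Icc_subset_Icc (by positivity)
      ((mul_le_mul_of_nonneg_right hJN hH.le).trans (succ_mul_mesh N).le))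
  rw [measureReal_def, unitMeasure_gridIdx_preimage hH, unitMeasure,
    Measure.restrict_apply measurableSet_Ico, Set.inter_eq_left.2 hsub, Real.volume_Ico, add_mul,
    one_mul, add_sub_cancel_left, ENNReal.toReal_ofReal hH.le]

theorem integral_comp_gridIdx_unitMeasure (N : ℕ) (φ : ℕ → ℝ) :
    ∫ t, φ (gridIdx (mesh N) t) ∂unitMeasure = mesh N * ∑ J ∈ Finset.range (N + 1), φ J := by
  rw [integral_comp_eq_sum (measurable_gridIdx _)
    (ae_unitMeasure_mem_Ico.mono fun t ht => gridIdx_mesh_mem_range N ht), mul_comm,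
    Finset.sum_mul]
  exact Finset.sum_congr rfl fun J hJ => by rw [unitMeasure_real_gridIdx_mesh hJ]

/-- Functions of different independent coordinates are orthogonal if at most one of them has a
nonzero mean. -/
theorem integral_sum_sq_pi {ι : Type*} [Fintype ι] {Ω : ι → Type*} [∀ i, MeasurableSpace (Ω i)]
    {μ : ∀ i, Measure (Ω i)} [∀ i, IsProbabilityMeasure (μ i)] {f : ∀ i, Ω i → ℝ}
    (hf : ∀ i, MemLp (f i) 2 (μ i)) (i₀ : ι) (h0 : ∀ i ≠ i₀, ∫ x, f i x ∂μ i = 0) :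
    ∫ x, (∑ i, f i (x i)) ^ 2 ∂Measure.pi μ = ∑ i, ∫ x, f i x ^ 2 ∂μ i := by
  have hmem : ∀ i, MemLp (fun x : ∀ i, Ω i => f i (x i)) 2 (Measure.pi μ) := fun i =>
    (hf i).comp_measurePreserving (measurePreserving_eval μ i)
  have hmean : ∫ x, ∑ i, f i (x i) ∂Measure.pi μ = ∫ x, f i₀ x ∂μ i₀ := by
    rw [integral_finsetSum _ fun i _ => (hmem i).integrable one_le_two]
    simp only [integral_comp_eval (hf _).aestronglyMeasurable]
    exact Finset.sum_eq_single_of_mem i₀ (Finset.mem_univ _) fun i _ hi => h0 i hi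
  have hsq : ∑ i, (∫ x, f i x ∂μ i) ^ 2 = (∫ x, f i₀ x ∂μ i₀) ^ 2 :=
    Finset.sum_eq_single_of_mem i₀ (Finset.mem_univ _) fun i _ hi => by rw [h0 i hi]; ring
  have hvar := ProbabilityTheory.variance_sum_pi hf
  rw [ProbabilityTheory.variance_eq_sub (memLp_finsetSum' _ fun i _ => hmem i),
    Finset.sum_congr rfl fun i _ => ProbabilityTheory.variance_eq_sub (hf i),
    Finset.sum_sub_distrib, hsq] at hvar
  simp only [Pi.pow_apply, Finset.sum_apply, hmean] at hvar
  linarith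

end Uniform

/-! ### Additive step functions -/

section AdditiveStep

variable {d : ℕ}

/-- The additive function that takes the value `∑ α, w α (J α)` on the product of the spline
intervals with indices `J α`. -/
def additiveStep (N : ℕ) (w : Fin d → ℕ → ℝ) (x : Fin d → ℝ) : ℝ :=
  ∑ α, w α (gridIdx (mesh N) (x α))

/-- The squared Euclidean length of the coefficients of an additive step function. -/
def sqLen (N : ℕ) (w : Fin d → ℕ → ℝ) : ℝ :=
  ∑ α, ∑ J ∈ Finset.range (N + 1), w α J ^ 2

/-- The coefficients of every component but the zeroth sum to zero. -/
def SumsToZero [NeZero d] (N : ℕ) (w : Fin d → ℕ → ℝ) : Prop :=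
  ∀ α, α ≠ 0 → ∑ J ∈ Finset.range (N + 1), w α J = 0

theorem integral_additiveStep_sq_cubeMeasure [NeZero d] {N : ℕ} {w : Fin d → ℕ → ℝ}
    (hw : SumsToZero N w) :
    ∫ x, additiveStep N w x ^ 2 ∂cubeMeasure d = mesh N * sqLen N w := by
  have hmem : ∀ α, MemLp (fun t => w α (gridIdx (mesh N) t)) 2 unitMeasure := fun α =>
    (memLp_two_iff_integrable_sq
      (measurable_from_nat.comp (measurable_gridIdx _)).aestronglyMeasurable).2
      (integrable_comp_of_ae_mem (measurable_gridIdx _)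
        (ae_unitMeasure_mem_Ico.mono fun t ht => gridIdx_mesh_mem_range N ht) fun J => w α J ^ 2)
  rw [sqLen, Finset.mul_sum]
  refine (integral_sum_sq_pi hmem 0 fun α hα => ?_).trans (Finset.sum_congr rfl fun α _ => ?_)
  · rw [integral_comp_gridIdx_unitMeasure, hw α hα, mul_zero]
  · exact integral_comp_gridIdx_unitMeasure N fun J => w α J ^ 2

theorem abs_additiveStep_le (N : ℕ) (w : Fin d → ℕ → ℝ) {x : Fin d → ℝ}
    (hx : x ∈ unitCube d) : |additiveStep N w x| ≤ ∑ α, ∑ J ∈ Finset.range (N + 1), |w α J| :=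
  (Finset.abs_sum_le_sum_abs _ _).trans (Finset.sum_le_sum fun α _ =>
    Finset.single_le_sum (f := fun J => |w α J|) (fun _ _ => abs_nonneg _)
      (gridIdx_mesh_mem_range N (hx α)))

theorem measurable_additiveStep (N : ℕ) (w : Fin d → ℕ → ℝ) : Measurable (additiveStep N w) :=
  Finset.measurable_fun_sum _ fun α _ =>
    measurable_from_nat.comp ((measurable_gridIdx _).comp (measurable_pi_apply α))

theorem integrable_additiveStep_sq {ν : Measure (Fin d → ℝ)} [IsFiniteMeasure ν]
    (hν : ∀ᵐ x ∂ν, x ∈ unitCube d) (N : ℕ) (w : Fin d → ℕ → ℝ) :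
    Integrable (fun x => additiveStep N w x ^ 2) ν := by
  refine Integrable.of_bound ((measurable_additiveStep N w).pow_const 2).aestronglyMeasurable
    ((∑ α, ∑ J ∈ Finset.range (N + 1), |w α J|) ^ 2) ?_
  filter_upwards [hν] with x hx
  rw [Real.norm_eq_abs, abs_pow]
  exact pow_le_pow_left₀ (abs_nonneg _) (abs_additiveStep_le N w hx) 2

/-- The points whose coordinates `α` and `β` have the indices `q.1` and `q.2` in the grids of mesh
`δ` and `ε`. -/
def cell (δ ε : ℝ) (α β : Fin d) (q : ℕ × ℕ) : Set (Fin d → ℝ) :=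
  (fun x => (gridIdx δ (x α), gridIdx ε (x β))) ⁻¹' {q}

theorem measurable_gridIdx_prod (δ ε : ℝ) (α β : Fin d) :
    Measurable fun x : Fin d → ℝ => (gridIdx δ (x α), gridIdx ε (x β)) :=
  ((measurable_gridIdx δ).comp (measurable_pi_apply α)).prodMk
    ((measurable_gridIdx ε).comp (measurable_pi_apply β))

theorem measurableSet_cell (δ ε : ℝ) (α β : Fin d) (q : ℕ × ℕ) :
    MeasurableSet (cell δ ε α β q) :=
  measurable_gridIdx_prod δ ε α β (measurableSet_singleton q)

theorem pairwiseDisjoint_cell (δ ε : ℝ) (α β : Fin d) (s : Set (ℕ × ℕ)) :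
    s.PairwiseDisjoint (cell δ ε α β) := fun _ _ _ _ hab =>
  Disjoint.preimage _ (Set.disjoint_singleton.2 hab)

theorem cubeMeasure_real_cell_le {δ ε : ℝ} (hδ : 0 < δ) (hε : 0 < ε) {α β : Fin d}
    (hαβ : α ≠ β) (q : ℕ × ℕ) : (cubeMeasure d).real (cell δ ε α β q) ≤ δ * ε := by
  have hindep : ProbabilityTheory.IndepFun (fun x : Fin d → ℝ => gridIdx δ (x α))
      (fun x => gridIdx ε (x β)) (cubeMeasure d) :=
    ((ProbabilityTheory.iIndepFun_pi (μ := fun _ : Fin d => unitMeasure) (X := fun _ => id)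
      fun _ => aemeasurable_id).indepFun hαβ).comp (measurable_gridIdx δ) (measurable_gridIdx ε)
  have hmeas : ∀ (η : ℝ) (J : ℕ), NullMeasurableSet (gridIdx η ⁻¹' {J}) unitMeasure := fun η J =>
    (measurable_gridIdx η (measurableSet_singleton J)).nullMeasurableSet
  have hprod : (cubeMeasure d) (cell δ ε α β q) =
      unitMeasure (gridIdx δ ⁻¹' {q.1}) * unitMeasure (gridIdx ε ⁻¹' {q.2}) := by
    rw [← (measurePreserving_eval_cubeMeasure α).measure_preimage (hmeas δ _),
      ← (measurePreserving_eval_cubeMeasure β).measure_preimage (hmeas ε _),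
      cell, ← Set.singleton_prod_singleton, Set.mk_preimage_prod]
    exact hindep.measure_inter_preimage_eq_mul _ _ (measurableSet_singleton _)
      (measurableSet_singleton _)
  rw [measureReal_def, hprod, ENNReal.toReal_mul]
  exact mul_le_mul (unitMeasure_real_gridIdx_le hδ _) (unitMeasure_real_gridIdx_le hε _)
    measureReal_nonneg hδ.le

theorem cubeMeasure_real_cell_self_le {δ : ℝ} (hδ : 0 < δ) (α : Fin d) (q : ℕ × ℕ) :
    (cubeMeasure d).real (cell δ δ α α q) ≤ δ := by
  refine le_trans ?_ (unitMeasure_real_gridIdx_le hδ q.1)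
  rw [← (measurePreserving_eval_cubeMeasure α).measureReal_preimage
    (measurable_gridIdx δ (measurableSet_singleton q.1)).nullMeasurableSet]
  exact measureReal_mono fun x hx => congrArg Prod.fst hx

end AdditiveStep

/-! ### Quasi-uniform designs -/

/-- The law `π` on the cube lies between `c` times and `C` times the uniform law; for a design
density this is the assumption that it is bounded away from `0` and `∞`. -/
structure QuasiUniform {d : ℕ} (c C : ℝ) (π : Measure (Fin d → ℝ)) : Prop where
  pos : 0 < c
  lower : ENNReal.ofReal c • cubeMeasure d ≤ π
  upper : π ≤ ENNReal.ofReal C • cubeMeasure d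

theorem DesignDensity.exists_quasiUniform {Ω : Type*} [MeasurableSpace Ω] {d : ℕ} {P : Measure Ω}
    {X : ℕ → Ω → (Fin d → ℝ)} (hdens : DesignDensity P X) :
    (∀ i, P.map (X i) = P.map (X 0)) ∧ ∃ c C, QuasiUniform c C (P.map (X 0)) := by
  obtain ⟨f, fm, c, C, hc, hlaw, -, hf, -⟩ := hdens
  have hbound : ∀ᵐ x ∂cubeMeasure d, c ≤ f x ∧ f x ≤ C := by
    rw [← volume_restrict_Icc_eq_cubeMeasure]
    exact (ae_restrict_mem measurableSet_Icc).mono hf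
  refine ⟨fun i => (hlaw i).trans (hlaw 0).symm, c, C, hc, ?_, ?_⟩ <;>
    rw [hlaw 0, volume_restrict_Icc_eq_cubeMeasure, ← withDensity_const] <;>
    refine withDensity_mono (hbound.mono fun x hx => ENNReal.ofReal_le_ofReal ?_)
  exacts [hx.1, hx.2]

namespace QuasiUniform

variable {d : ℕ} {c C : ℝ} {π : Measure (Fin d → ℝ)}

theorem le (h : QuasiUniform c C π) : c ≤ C := by
  have hle := (h.lower.trans h.upper) Set.univ
  simp only [Measure.smul_apply, measure_univ, smul_eq_mul, mul_one] at hle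
  exact le_of_not_gt fun hlt =>
    absurd hle ((ENNReal.ofReal_lt_ofReal_iff h.pos).2 hlt).not_ge

theorem upper_pos (h : QuasiUniform c C π) : 0 < C := h.pos.trans_le h.le

theorem ae_mem_unitCube (h : QuasiUniform c C π) : ∀ᵐ x ∂π, x ∈ unitCube d :=
  ((Measure.absolutelyContinuous_of_le h.upper).trans Measure.smul_absolutelyContinuous).ae_le
    (ae_cubeMeasure_mem_unitCube d)

theorem real_le (h : QuasiUniform c C π) (A : Set (Fin d → ℝ)) :
    π.real A ≤ C * (cubeMeasure d).real A := by
  have hA := ENNReal.toReal_mono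
    (ENNReal.mul_ne_top ENNReal.ofReal_ne_top (measure_ne_top (cubeMeasure d) A)) (h.upper A)
  rwa [ENNReal.toReal_mul, ENNReal.toReal_ofReal h.upper_pos.le] at hA

theorem real_cell_le (h : QuasiUniform c C π) {δ ε : ℝ} (hδ : 0 < δ) (hε : 0 < ε) {α β : Fin d}
    (hαβ : α ≠ β) (q : ℕ × ℕ) : π.real (cell δ ε α β q) ≤ C * (δ * ε) :=
  (h.real_le _).trans
    (mul_le_mul_of_nonneg_left (cubeMeasure_real_cell_le hδ hε hαβ q) h.upper_pos.le)

theorem real_cell_self_le (h : QuasiUniform c C π) {δ : ℝ} (hδ : 0 < δ) (α : Fin d) (q : ℕ × ℕ) :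
    π.real (cell δ δ α α q) ≤ C * δ :=
  (h.real_le _).trans
    (mul_le_mul_of_nonneg_left (cubeMeasure_real_cell_self_le hδ α q) h.upper_pos.le)

theorem map_eval_lower (h : QuasiUniform c C π) (α : Fin d) :
    ENNReal.ofReal c • unitMeasure ≤ π.map fun x => x α := by
  rw [← (measurePreserving_eval_cubeMeasure α).map_eq, ← Measure.map_smul]
  exact Measure.map_mono h.lower (measurable_pi_apply α)

theorem le_integral_additiveStep_sq [NeZero d] [IsFiniteMeasure π] (h : QuasiUniform c C π) {N : ℕ}
    {w : Fin d → ℕ → ℝ} (hw : SumsToZero N w) :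
    c * (mesh N * sqLen N w) ≤ ∫ x, additiveStep N w x ^ 2 ∂π := by
  rw [← integral_additiveStep_sq_cubeMeasure hw, ← smul_eq_mul, ← ENNReal.toReal_ofReal h.pos.le,
    ← integral_smul_measure]
  exact integral_mono_measure h.lower (Eventually.of_forall fun x => sq_nonneg _)
    (integrable_additiveStep_sq h.ae_mem_unitCube N w)

end QuasiUniform

/-! ### The span of the constant spline basis -/

section Spline

theorem stepFn_eq_ite (N J : ℕ) {t : ℝ} (ht : 0 ≤ t) :
    stepFn N J t = if J = gridIdx (mesh N) t then 1 else 0 := by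
  rw [stepFn, Set.indicator_apply]
  exact if_congr (by rw [← gridIdx_eq_iff (mesh_pos N) ht, eq_comm]) rfl rfl

theorem measurable_stepFn (N J : ℕ) : Measurable (stepFn N J) :=
  measurable_const.indicator measurableSet_Ico

theorem stepFn_sq (N J : ℕ) (t : ℝ) : stepFn N J t ^ 2 = stepFn N J t := by
  simp only [stepFn, Set.indicator_apply]
  split_ifs <;> norm_num

theorem stepFn_nonneg (N J : ℕ) (t : ℝ) : 0 ≤ stepFn N J t :=
  Set.indicator_nonneg (fun _ _ => zero_le_one) t

theorem stepFn_le_one (N J : ℕ) (t : ℝ) : stepFn N J t ≤ 1 :=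
  Set.indicator_le_self' (fun _ _ => zero_le_one) t

theorem stepFn_succ_mul_stepFn (N J : ℕ) (t : ℝ) : stepFn N (J + 1) t * stepFn N J t = 0 := by
  simp only [stepFn, mul_one, ← Set.inter_indicator_mul]
  refine Set.indicator_of_notMem (fun ht => ?_) _
  have hle := ht.1.1
  rw [Nat.cast_succ] at hle
  exact hle.not_gt ht.2.2

theorem integral_stepFn_sq (μ : Measure ℝ) (N J : ℕ) :
    ∫ t, stepFn N J t ^ 2 ∂μ =
      μ.real (Set.Ico ((J : ℝ) * mesh N) (((J : ℝ) + 1) * mesh N)) := by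
  simp only [stepFn_sq]
  unfold stepFn
  rw [integral_indicator_const _ measurableSet_Ico, smul_eq_mul, mul_one]

theorem l2Norm_stepFn_pos {μ : Measure ℝ} [IsFiniteMeasure μ] {c : ℝ} (hc : 0 < c)
    (hμ : ENNReal.ofReal c • unitMeasure ≤ μ) {N J : ℕ} (hJ : J ∈ Finset.range (N + 1)) :
    0 < l2Norm μ (stepFn N J) := by
  have hunit : unitMeasure (Set.Ico ((J : ℝ) * mesh N) (((J : ℝ) + 1) * mesh N)) ≠ 0 := by
    intro h0
    have hmesh := unitMeasure_real_gridIdx_mesh hJ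
    rw [measureReal_def, unitMeasure_gridIdx_preimage (mesh_pos N), h0] at hmesh
    exact (mesh_pos N).ne hmesh
  rw [l2Norm, integral_stepFn_sq]
  refine Real.sqrt_pos.2 (ENNReal.toReal_pos (ne_of_gt ?_) (measure_ne_top _ _))
  exact (ENNReal.mul_pos (ENNReal.ofReal_pos.2 hc).ne' hunit).trans_le (hμ _)

variable {μ : Measure ℝ} [IsFiniteMeasure μ]

theorem integrable_splineb_sq (N J : ℕ) : Integrable (fun t => splineb μ N J t ^ 2) μ := by
  have hmem : ∀ J, MemLp (stepFn N J) 2 μ := fun J =>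
    .of_bound (measurable_stepFn N J).aestronglyMeasurable 1 <| Eventually.of_forall fun t => by
      rw [Real.norm_of_nonneg (stepFn_nonneg N J t)]
      exact stepFn_le_one N J t
  exact ((hmem (J + 1)).sub ((hmem J).const_mul _)).integrable_sq

theorem l2Norm_splineb_pos {N J : ℕ} (hJ : 0 < l2Norm μ (stepFn N (J + 1))) :
    0 < l2Norm μ (splineb μ N J) := by
  refine hJ.trans_le (Real.sqrt_le_sqrt (integral_mono_of_nonneg
    (Eventually.of_forall fun t => sq_nonneg _) (integrable_splineb_sq N J)
    (Eventually.of_forall fun t => ?_)))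
  set r := l2Norm μ (stepFn N (J + 1)) / l2Norm μ (stepFn N J) with hr
  have hsq : splineb μ N J t ^ 2 = stepFn N (J + 1) t ^ 2 + (r * stepFn N J t) ^ 2 := by
    rw [splineb, ← hr]
    linear_combination -2 * r * stepFn_succ_mul_stepFn N J t
  exact (le_add_of_nonneg_right (sq_nonneg _)).trans_eq hsq.symm

theorem l2Norm_mul_splineB {N J : ℕ} (hJ : 0 < l2Norm μ (stepFn N (J + 1))) (t : ℝ) :
    l2Norm μ (splineb μ N J) * splineB μ N J t = splineb μ N J t := by
  rw [splineB, mul_div_cancel₀ _ (l2Norm_splineb_pos hJ).ne']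

theorem exists_centered_partial_sums (v : ℕ → ℝ) {w : ℕ → ℝ} {N : ℕ}
    (hw : ∀ J ∈ Finset.range (N + 1), 0 < w J) :
    ∃ (κ : ℝ) (S : ℕ → ℝ), S 0 = 0 ∧ S (N + 1) = 0 ∧ ∀ J, S (J + 1) = S J + (v J - κ) * w J := by
  have hpos : 0 < ∑ J ∈ Finset.range (N + 1), w J := Finset.sum_pos hw ⟨0, by simp⟩
  refine ⟨(∑ J ∈ Finset.range (N + 1), v J * w J) / ∑ J ∈ Finset.range (N + 1), w J,
    fun J => ∑ i ∈ Finset.range J, (v i - _) * w i, Finset.sum_range_zero _, ?_,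
    fun J => Finset.sum_range_succ _ _⟩
  simp only [sub_mul, Finset.sum_sub_distrib, ← Finset.mul_sum]
  rw [div_mul_cancel₀ _ hpos.ne', sub_self]

/-- If `κ` is the `w`-weighted mean of `v` and `S` are the partial sums of `(v - κ) w`, where
`w J = ‖I_J‖`, then `v_J - κ` is the increment of `S` over `w J`, so that summation by parts gives
the coefficients `- S_{J+1} / w_{J+1}` on `b_J`. -/
theorem exists_spline_eq {N : ℕ} (hμ : ∀ J ∈ Finset.range (N + 1), 0 < l2Norm μ (stepFn N J))
    (v : ℕ → ℝ) :
    ∃ (κ : ℝ) (l : Fin N → ℝ), ∀ t ∈ Set.Ico (0 : ℝ) 1,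
      κ + ∑ J : Fin N, l J * splineB μ N J t = v (gridIdx (mesh N) t) := by
  obtain ⟨κ, S, hS0, hSN, hS⟩ := exists_centered_partial_sums v hμ
  set w : ℕ → ℝ := fun J => l2Norm μ (stepFn N J)
  have hw : ∀ J ∈ Finset.range (N + 1), w J ≠ 0 := fun J hJ => (hμ J hJ).ne'
  refine ⟨κ, fun J => -(S (J + 1) / w (J + 1)) * l2Norm μ (splineb μ N J), fun t ht => ?_⟩
  set T : ℕ → ℝ := fun J => -(S J / w J) * stepFn N J t
  have hterm : ∀ J ∈ Finset.range N,
      -(S (J + 1) / w (J + 1)) * l2Norm μ (splineb μ N J) * splineB μ N J t =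
        T (J + 1) - T J + (v J - κ) * stepFn N J t := by
    intro J hJ
    have hJ1 : J + 1 ∈ Finset.range (N + 1) := by simpa using hJ
    have hwJ := hw J (Finset.mem_range_succ_iff.2 (Finset.mem_range.1 hJ).le)
    have hwJ1 := hw (J + 1) hJ1
    change _ = -(S (J + 1) / w (J + 1)) * stepFn N (J + 1) t - -(S J / w J) * stepFn N J t + _
    rw [mul_assoc, l2Norm_mul_splineB (hμ _ hJ1), splineb, hS]
    change _ * (_ - w (J + 1) / w J * _) = _
    field_simp
    ring
  have hTN : T N = (v N - κ) * stepFn N N t := by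
    have hSN' : S N = -((v N - κ) * w N) := by linarith [hS N]
    rw [show T N = -(S N / w N) * stepFn N N t from rfl, hSN', neg_div, neg_neg,
      mul_div_cancel_right₀ _ (hw N (Finset.self_mem_range_succ N))]
  have hT0 : T 0 = 0 := by simp [T, hS0]
  have hvalue : ∑ J ∈ Finset.range (N + 1), (v J - κ) * stepFn N J t =
      v (gridIdx (mesh N) t) - κ := by
    simp only [stepFn_eq_ite N _ ht.1, mul_ite, mul_one, mul_zero]
    rw [Finset.sum_ite_eq' _ _ (fun J => v J - κ), if_pos (gridIdx_mesh_mem_range N ht)]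
  rw [Finset.sum_range_succ] at hvalue
  rw [Fin.sum_univ_eq_sum_range (fun J => -(S (J + 1) / w (J + 1)) * l2Norm μ (splineb μ N J) *
    splineB μ N J t), Finset.sum_congr rfl hterm, Finset.sum_add_distrib, Finset.sum_range_sub,
    hTN, hT0]
  linarith

end Spline

section AdditiveSpline

variable {d N : ℕ}

theorem exists_additiveSpline_eq {μ : Fin d → Measure ℝ} [∀ α, IsFiniteMeasure (μ α)]
    (hμ : ∀ α, ∀ J ∈ Finset.range (N + 1), 0 < l2Norm (μ α) (stepFn N J)) (c₀ : ℝ)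
    (v : Fin d → ℕ → ℝ) :
    ∃ b : SplineCoeff d N, ∀ x ∈ unitCube d, additiveSpline μ b x = c₀ + additiveStep N v x := by
  choose κ l hl using fun α => exists_spline_eq (hμ α) (v α)
  refine ⟨(c₀ + ∑ α, κ α, l), fun x hx => ?_⟩
  simp only [additiveSpline, splineComponent, additiveStep]
  rw [add_assoc, ← Finset.sum_add_distrib]
  exact congrArg (c₀ + ·) (Finset.sum_congr rfl fun α _ => hl α (x α) (hx α))

theorem gridIdx_node (N J : ℕ) : gridIdx (mesh N) (J * mesh N) = J := by
  rw [gridIdx, mul_div_cancel_right₀ _ (mesh_pos N).ne', Nat.floor_natCast]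

theorem node_nonneg (N J : ℕ) : 0 ≤ (J : ℝ) * mesh N :=
  mul_nonneg J.cast_nonneg (mesh_pos N).le

theorem splineComponent_node (μ : Fin d → Measure ℝ) (a : SplineCoeff d N) (α : Fin d) {t : ℝ}
    (ht : 0 ≤ t) :
    splineComponent μ a α t = splineComponent μ a α (gridIdx (mesh N) t * mesh N) := by
  have hstep : ∀ J, stepFn N J t = stepFn N J (gridIdx (mesh N) t * mesh N) := fun J => by
    rw [stepFn_eq_ite N J ht, stepFn_eq_ite N J (node_nonneg N _), gridIdx_node]
  simp only [splineComponent, splineB, splineb, hstep]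

theorem additiveSpline_eq_additiveStep (μ : Fin d → Measure ℝ) (a : SplineCoeff d N)
    {x : Fin d → ℝ} (hx : x ∈ unitCube d) :
    additiveSpline μ a x =
      a.1 + additiveStep N (fun α J => splineComponent μ a α (J * mesh N)) x :=
  congrArg (a.1 + ·) (Finset.sum_congr rfl fun α _ => splineComponent_node μ a α (hx α).1)

end AdditiveSpline

/-! ### The Gram matrix of the interval indicators -/

section Gram

variable {d : ℕ}

/-- The indices of the entries of the Gram matrix of all the indicators `I_J(x_α)`. -/
def gramIdx (d N : ℕ) : Finset ((Fin d × Fin d) × (ℕ × ℕ)) :=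
  Finset.univ ×ˢ (Finset.range (N + 1) ×ˢ Finset.range (N + 1))

/-- The event whose probability is an entry of the Gram matrix of the indicators `I_J(x_α)`. -/
def gramCell (N : ℕ) (q : (Fin d × Fin d) × (ℕ × ℕ)) : Set (Fin d → ℝ) :=
  cell (mesh N) (mesh N) q.1.1 q.1.2 q.2

/-- The points whose `β`-th coordinate lies in the `J`-th interval. -/
def slab (N : ℕ) (β : Fin d) (J : ℕ) : Set (Fin d → ℝ) :=
  (fun x => gridIdx (mesh N) (x β)) ⁻¹' {J}

theorem gramCell_self (N : ℕ) (β : Fin d) (J : ℕ) :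
    gramCell N ((β, β), (J, J)) = slab N β J := by
  ext x
  exact Prod.mk_inj.trans (and_self_iff)

theorem sqLen_nonneg (N : ℕ) (w : Fin d → ℕ → ℝ) : 0 ≤ sqLen N w :=
  Finset.sum_nonneg fun _ _ => Finset.sum_nonneg fun _ _ => sq_nonneg _

theorem sum_sq_le_sqLen (N : ℕ) (w : Fin d → ℕ → ℝ) (β : Fin d) :
    ∑ J ∈ Finset.range (N + 1), w β J ^ 2 ≤ sqLen N w :=
  Finset.single_le_sum (f := fun α => ∑ J ∈ Finset.range (N + 1), w α J ^ 2)
    (fun _ _ => Finset.sum_nonneg fun _ _ => sq_nonneg _) (Finset.mem_univ β)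

theorem integral_additiveStep_sq_eq {ν : Measure (Fin d → ℝ)} [IsFiniteMeasure ν]
    (hν : ∀ᵐ x ∂ν, x ∈ unitCube d) (N : ℕ) (w : Fin d → ℕ → ℝ) :
    ∫ x, additiveStep N w x ^ 2 ∂ν =
      ∑ q ∈ gramIdx d N, w q.1.1 q.2.1 * w q.1.2 q.2.2 * ν.real (gramCell N q) := by
  have hidx : ∀ α β : Fin d, ∀ᵐ x ∂ν, (gridIdx (mesh N) (x α), gridIdx (mesh N) (x β)) ∈
      Finset.range (N + 1) ×ˢ Finset.range (N + 1) := fun α β => hν.mono fun x hx =>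
    Finset.mk_mem_product (gridIdx_mesh_mem_range N (hx α)) (gridIdx_mesh_mem_range N (hx β))
  have hint : ∀ α β : Fin d, Integrable
      (fun x => w α (gridIdx (mesh N) (x α)) * w β (gridIdx (mesh N) (x β))) ν := fun α β =>
    integrable_comp_of_ae_mem (measurable_gridIdx_prod _ _ α β) (hidx α β)
      fun c => w α c.1 * w β c.2
  simp only [additiveStep, sq, Finset.sum_mul_sum]
  rw [integral_finsetSum _ fun α _ => integrable_finsetSum _ fun β _ => hint α β, gramIdx,
    Finset.sum_product, Fintype.sum_prod_type]
  refine Finset.sum_congr rfl fun α _ => ?_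
  rw [integral_finsetSum _ fun β _ => hint α β]
  exact Finset.sum_congr rfl fun β _ => integral_comp_eq_sum (measurable_gridIdx_prod _ _ α β)
    (hidx α β) fun c => w α c.1 * w β c.2

theorem sum_gramIdx_sq (N : ℕ) (w : Fin d → ℕ → ℝ) :
    ∑ q ∈ gramIdx d N, (w q.1.1 q.2.1 * w q.1.2 q.2.2) ^ 2 = sqLen N w ^ 2 := by
  rw [gramIdx, Finset.sum_product, Fintype.sum_prod_type, sq (sqLen N w), sqLen,
    Finset.sum_mul_sum]
  refine Finset.sum_congr rfl fun α _ => Finset.sum_congr rfl fun β _ => ?_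
  rw [Finset.sum_product, Finset.sum_mul_sum]
  exact Finset.sum_congr rfl fun J _ => Finset.sum_congr rfl fun J' _ => mul_pow _ _ _

variable {ν π : Measure (Fin d → ℝ)} {N : ℕ}

theorem QuasiUniform.real_slab_le {c C : ℝ} (hπ : QuasiUniform c C π)
    (hgram : sqError ν π (gramIdx d N) (gramCell N) ≤ (c * mesh N / 2) ^ 2) (β : Fin d) {J : ℕ}
    (hJ : J ∈ Finset.range (N + 1)) : ν.real (slab N β J) ≤ 2 * C * mesh N := by
  have hq : ((β, β), (J, J)) ∈ gramIdx d N :=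
    Finset.mk_mem_product (Finset.mem_univ _) (Finset.mk_mem_product hJ hJ)
  have hcH := mul_pos hπ.pos (mesh_pos N)
  have herr := (abs_le_of_sq_le_sq' ((Finset.single_le_sum
    (f := fun q => (ν.real (gramCell N q) - π.real (gramCell N q)) ^ 2)
    (fun _ _ => sq_nonneg _) hq).trans hgram) (by positivity)).2
  have hcell : π.real (gramCell N ((β, β), (J, J))) ≤ C * mesh N :=
    hπ.real_cell_self_le (mesh_pos N) β _
  rw [← gramCell_self]
  linarith [mul_le_mul_of_nonneg_right hπ.le (mesh_pos N).le]

variable [IsFiniteMeasure ν] [IsFiniteMeasure π]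

theorem abs_integral_additiveStep_sq_sub_le (hν : ∀ᵐ x ∂ν, x ∈ unitCube d)
    (hπ : ∀ᵐ x ∂π, x ∈ unitCube d) (w : Fin d → ℕ → ℝ) {b : ℝ} (hb : 0 ≤ b)
    (hgram : sqError ν π (gramIdx d N) (gramCell N) ≤ b ^ 2) :
    |∫ x, additiveStep N w x ^ 2 ∂ν - ∫ x, additiveStep N w x ^ 2 ∂π| ≤ sqLen N w * b := by
  rw [integral_additiveStep_sq_eq hν, integral_additiveStep_sq_eq hπ, ← Finset.sum_sub_distrib]
  simp only [← mul_sub]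
  refine abs_le_of_sq_le_sq ?_ (mul_nonneg (sqLen_nonneg N w) hb)
  rw [mul_pow, ← sum_gramIdx_sq]
  exact (Finset.sum_mul_sq_le_sq_mul_sq _ _ _).trans
    (mul_le_mul_of_nonneg_left hgram (Finset.sum_nonneg fun _ _ => sq_nonneg _))

theorem QuasiUniform.le_integral_additiveStep_sq_of_sqError_le [NeZero d] {c C : ℝ}
    (hπ : QuasiUniform c C π) (hν : ∀ᵐ x ∂ν, x ∈ unitCube d)
    (hgram : sqError ν π (gramIdx d N) (gramCell N) ≤ (c * mesh N / 2) ^ 2)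
    {w : Fin d → ℕ → ℝ} (hw : SumsToZero N w) :
    c * mesh N / 2 * sqLen N w ≤ ∫ x, additiveStep N w x ^ 2 ∂ν := by
  have hb : 0 ≤ c * mesh N / 2 := by
    have := mul_pos hπ.pos (mesh_pos N)
    positivity
  have hdiff := (abs_le.1
    (abs_integral_additiveStep_sq_sub_le hν hπ.ae_mem_unitCube w hb hgram)).1
  linarith [hπ.le_integral_additiveStep_sq hw]

end Gram

/-! ### The least squares fit -/

section LeastSquares

theorem exists_sumsToZero {d : ℕ} [NeZero d] (N : ℕ) (u : ℝ) (v : Fin d → ℕ → ℝ) :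
    ∃ w : Fin d → ℕ → ℝ, SumsToZero N w ∧ (∀ x, u + additiveStep N v x = additiveStep N w x) ∧
      ∀ β, ∃ κ : ℝ, ∀ J, v β J = w β J + κ := by
  set avg : Fin d → ℝ := fun α => mesh N * ∑ J ∈ Finset.range (N + 1), v α J
  refine ⟨fun α J => v α J - avg α + if α = 0 then u + ∑ β, avg β else 0, fun α hα => ?_,
    fun x => ?_, fun β => ⟨avg β - if β = 0 then u + ∑ γ, avg γ else 0, fun J => by ring⟩⟩
  · simp only [if_neg hα, add_zero, Finset.sum_sub_distrib, Finset.sum_const, Finset.card_range,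
      nsmul_eq_mul, Nat.cast_succ, avg]
    rw [← mul_assoc, succ_mul_mesh, one_mul, sub_self]
  · simp only [additiveStep, Finset.sum_add_distrib, Finset.sum_sub_distrib,
      Finset.sum_ite_eq', Finset.mem_univ, if_true]
    ring

theorem sum_sub_sq_le_of_sum_sq_le {ι : Type*} {s : Finset ι} {y f g : ι → ℝ}
    (hfg : ∑ i ∈ s, (y i - f i) ^ 2 ≤ ∑ i ∈ s, (y i - g i) ^ 2) :
    ∑ i ∈ s, (f i - g i) ^ 2 ≤ 4 * ∑ i ∈ s, (y i - g i) ^ 2 := by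
  have hpt : ∀ i ∈ s, (f i - g i) ^ 2 ≤ 2 * (y i - f i) ^ 2 + 2 * (y i - g i) ^ 2 :=
    fun i _ => by nlinarith [sq_nonneg ((y i - f i) + (y i - g i))]
  refine (Finset.sum_le_sum hpt).trans ?_
  rw [Finset.sum_add_distrib, ← Finset.mul_sum, ← Finset.mul_sum]
  linarith

theorem abs_sub_node_le (N : ℕ) {t : ℝ} (ht : 0 ≤ t) :
    |t - gridIdx (mesh N) t * mesh N| ≤ mesh N := by
  have h := (gridIdx_eq_iff (mesh_pos N) ht _).1 rfl
  rw [abs_of_nonneg (sub_nonneg.2 h.1)]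
  linarith [h.2]

theorem node_mem_Icc (N : ℕ) {t : ℝ} (ht : t ∈ Set.Ico (0 : ℝ) 1) :
    (gridIdx (mesh N) t : ℝ) * mesh N ∈ Set.Icc (0 : ℝ) 1 :=
  ⟨node_nonneg N _, (((gridIdx_eq_iff (mesh_pos N) ht.1 _).1 rfl).1.trans_lt ht.2).le⟩

theorem abs_sub_comp_node_le {l : NNReal} {f : ℝ → ℝ} (hf : LipschitzOnWith l f (Set.Icc 0 1))
    (N : ℕ) {t : ℝ} (ht : t ∈ Set.Ico (0 : ℝ) 1) :
    |f t - f (gridIdx (mesh N) t * mesh N)| ≤ l * mesh N :=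
  (hf.dist_le_mul t (Set.Ico_subset_Icc_self ht) _ (node_mem_Icc N ht)).trans
    (mul_le_mul_of_nonneg_left (abs_sub_node_le N ht.1) l.coe_nonneg)

variable {d N n : ℕ} {μ : Fin d → Measure ℝ} {x : ℕ → Fin d → ℝ} {c₀ : ℝ} {m : Fin d → ℝ → ℝ}
  {l : NNReal} {a : SplineCoeff d N}

theorem abs_additiveMean_sub_node_le (c₀ : ℝ) (hm : ∀ α, LipschitzOnWith l (m α) (Set.Icc 0 1))
    (N : ℕ) {y : Fin d → ℝ} (hy : y ∈ unitCube d) :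
    |additiveMean c₀ m y - (c₀ + additiveStep N (fun α J => m α (J * mesh N)) y)| ≤
      d * (l * mesh N) := by
  rw [additiveMean, additiveStep, add_sub_add_left_eq_sub, ← Finset.sum_sub_distrib]
  refine (Finset.abs_sum_le_sum_abs _ _).trans ?_
  exact (Finset.sum_le_sum fun α _ => abs_sub_comp_node_le (hm α) N (hy α)).trans_eq (by simp)

/-- The difference between the `α`-th spline component and `m α` at the node `J H`. -/
def nodeError (μ : Fin d → Measure ℝ) (m : Fin d → ℝ → ℝ) (a : SplineCoeff d N) (α : Fin d)
    (J : ℕ) : ℝ :=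
  splineComponent μ a α (J * mesh N) - m α (J * mesh N)

theorem IsLeastSquares.integral_nodeError_sq_le [∀ α, IsFiniteMeasure (μ α)]
    (hμ : ∀ α, ∀ J ∈ Finset.range (N + 1), 0 < l2Norm (μ α) (stepFn N J)) (hn : 0 < n)
    (hx : ∀ i, x i ∈ unitCube d) (hm : ∀ α, LipschitzOnWith l (m α) (Set.Icc 0 1))
    (ha : IsLeastSquares μ n x (fun i => additiveMean c₀ m (x i)) a) :
    ∫ y, (a.1 - c₀ + additiveStep N (nodeError μ m a) y) ^ 2 ∂empirical n x ≤
      4 * (d * (l * mesh N)) ^ 2 := by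
  obtain ⟨b, hb⟩ := exists_additiveSpline_eq hμ c₀ fun α J => m α (J * mesh N)
  have happrox : ∀ i ∈ Finset.range n,
      (additiveMean c₀ m (x i) - additiveSpline μ b (x i)) ^ 2 ≤ (d * (l * mesh N)) ^ 2 :=
    fun i _ => by
      rw [hb _ (hx i)]
      exact sq_le_sq' (abs_le.1 (abs_additiveMean_sub_node_le c₀ hm N (hx i))).1
        (abs_le.1 (abs_additiveMean_sub_node_le c₀ hm N (hx i))).2
  have herr : ∀ i, a.1 - c₀ + additiveStep N (nodeError μ m a) (x i) =
      additiveSpline μ a (x i) - additiveSpline μ b (x i) := fun i => by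
    rw [additiveSpline_eq_additiveStep μ a (hx i), hb _ (hx i), add_sub_add_comm]
    simp only [additiveStep, nodeError, Finset.sum_sub_distrib]
  have hn' : (0 : ℝ) < n := by exact_mod_cast hn
  simp only [integral_empirical, herr]
  rw [inv_mul_le_iff₀ hn']
  refine (sum_sub_sq_le_of_sum_sq_le (ha b)).trans
    ((mul_le_mul_of_nonneg_left (Finset.sum_le_sum happrox) zero_le_four).trans_eq ?_)
  simp only [Finset.sum_const, Finset.card_range, nsmul_eq_mul]
  ring

theorem IsLeastSquares.exists_sqLen_le [NeZero d] [∀ α, IsFiniteMeasure (μ α)]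
    (hμ : ∀ α, ∀ J ∈ Finset.range (N + 1), 0 < l2Norm (μ α) (stepFn N J)) (hn : 0 < n)
    (hx : ∀ i, x i ∈ unitCube d) (hm : ∀ α, LipschitzOnWith l (m α) (Set.Icc 0 1))
    (ha : IsLeastSquares μ n x (fun i => additiveMean c₀ m (x i)) a) {c : ℝ} (hc : 0 < c)
    (hcoer : ∀ w, SumsToZero N w →
      c * mesh N / 2 * sqLen N w ≤ ∫ y, additiveStep N w y ^ 2 ∂empirical n x) :
    ∃ w : Fin d → ℕ → ℝ, sqLen N w ≤ 8 * (d * l) ^ 2 / c * mesh N ∧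
      ∀ β, ∃ κ : ℝ, ∀ J, nodeError μ m a β J = w β J + κ := by
  obtain ⟨w, hw, hstep, hκ⟩ := exists_sumsToZero N (a.1 - c₀) (nodeError μ m a)
  refine ⟨w, ?_, hκ⟩
  have hH := mesh_pos N
  have hfit := ha.integral_nodeError_sq_le hμ hn hx hm
  simp only [hstep] at hfit
  refine (le_div_iff₀' (show 0 < c * mesh N / 2 by positivity)).2
    ((hcoer w hw).trans hfit) |>.trans_eq ?_
  field_simp
  ring

end LeastSquares

/-! ### Weights of the slabs -/

section Slabs

variable {d : ℕ} {ν : Measure (Fin d → ℝ)} {N : ℕ}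

theorem measurableSet_slab (N : ℕ) (β : Fin d) (J : ℕ) : MeasurableSet (slab N β J) :=
  ((measurable_gridIdx _).comp (measurable_pi_apply β)) (measurableSet_singleton J)

theorem mul_comp_gridIdx_eq_sum_indicator (g : (Fin d → ℝ) → ℝ) (φ : ℕ → ℝ) (β : Fin d)
    {y : Fin d → ℝ} (hy : y ∈ unitCube d) :
    g y * φ (gridIdx (mesh N) (y β)) =
      ∑ J ∈ Finset.range (N + 1), (slab N β J).indicator g y * φ J := by
  rw [Finset.sum_eq_single_of_mem _ (gridIdx_mesh_mem_range N (hy β)),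
    Set.indicator_of_mem (show y ∈ slab N β _ from rfl)]
  intro J _ hJ
  rw [Set.indicator_of_notMem fun hyJ : y ∈ slab N β J => hJ hyJ.symm, zero_mul]

variable {g : (Fin d → ℝ) → ℝ}

theorem integrable_mul_comp_gridIdx (hν : ∀ᵐ y ∂ν, y ∈ unitCube d) (hg : Integrable g ν)
    (N : ℕ) (β : Fin d) (φ : ℕ → ℝ) :
    Integrable (fun y => g y * φ (gridIdx (mesh N) (y β))) ν :=
  (integrable_finsetSum (Finset.range (N + 1)) fun J _ =>
    (hg.indicator (measurableSet_slab N β J)).mul_const (φ J)).congr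
      (hν.mono fun _ hy => (mul_comp_gridIdx_eq_sum_indicator g φ β hy).symm)

theorem integral_mul_comp_gridIdx (hν : ∀ᵐ y ∂ν, y ∈ unitCube d) (hg : Integrable g ν)
    (N : ℕ) (β : Fin d) (φ : ℕ → ℝ) :
    ∫ y, g y * φ (gridIdx (mesh N) (y β)) ∂ν =
      ∑ J ∈ Finset.range (N + 1), (∫ y in slab N β J, g y ∂ν) * φ J := by
  rw [integral_congr_ae (hν.mono fun _ hy => mul_comp_gridIdx_eq_sum_indicator g φ β hy),
    integral_finsetSum _ fun J _ => (hg.indicator (measurableSet_slab N β J)).mul_const (φ J)]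
  exact Finset.sum_congr rfl fun J _ => by
    rw [integral_mul_const, integral_indicator (measurableSet_slab N β J)]

theorem sum_mul_abs_add_le {T w : ℕ → ℝ} {A Q D : ℝ} (hD : 0 ≤ D)
    (hT : ∑ J ∈ Finset.range (N + 1), T J ^ 2 ≤ A * mesh N)
    (hw : ∑ J ∈ Finset.range (N + 1), w J ^ 2 ≤ Q * mesh N) :
    ∑ J ∈ Finset.range (N + 1), T J * (|w J| + D) ≤ √A * (√Q * mesh N + D) := by
  have hH := mesh_pos N
  have hA : 0 ≤ A := nonneg_of_mul_nonneg_left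
    ((Finset.sum_nonneg fun _ _ => sq_nonneg _).trans hT) hH
  have hQ : 0 ≤ Q := nonneg_of_mul_nonneg_left
    ((Finset.sum_nonneg fun _ _ => sq_nonneg _).trans hw) hH
  have hTw : ∑ J ∈ Finset.range (N + 1), T J * |w J| ≤ √A * √Q * mesh N := by
    refine (Real.sum_mul_le_sqrt_mul_sqrt _ _ _).trans ?_
    simp only [sq_abs]
    refine (mul_le_mul (Real.sqrt_le_sqrt hT) (Real.sqrt_le_sqrt hw) (Real.sqrt_nonneg _)
      (Real.sqrt_nonneg _)).trans_eq ?_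
    rw [Real.sqrt_mul hA, Real.sqrt_mul hQ, mul_mul_mul_comm, Real.mul_self_sqrt hH.le]
  have hT1 : ∑ J ∈ Finset.range (N + 1), T J ≤ √A := by
    refine Real.le_sqrt_of_sq_le (sq_sum_le_card_mul_sum_sq.trans ?_)
    rw [Finset.card_range, Nat.cast_succ]
    refine (mul_le_mul_of_nonneg_left hT (by positivity)).trans_eq ?_
    rw [mul_left_comm, succ_mul_mesh, mul_one]
  simp only [mul_add, Finset.sum_add_distrib, ← Finset.sum_mul, ← mul_assoc]
  exact add_le_add hTw (mul_le_mul_of_nonneg_right hT1 hD)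

/-- Bounds a weighted mean through Cauchy–Schwarz over the slabs, which loses no power of `H`
because the slab weights are of mean square order `H`. -/
theorem abs_integral_mul_le_of_sum_sq_le (hν : ∀ᵐ y ∂ν, y ∈ unitCube d) (hg : Integrable g ν)
    (hg0 : ∀ y, 0 ≤ g y) {β : Fin d} {A Q D : ℝ} (hD : 0 ≤ D)
    (hA : ∑ J ∈ Finset.range (N + 1), (∫ y in slab N β J, g y ∂ν) ^ 2 ≤ A * mesh N)
    {w : ℕ → ℝ} (hw : ∑ J ∈ Finset.range (N + 1), w J ^ 2 ≤ Q * mesh N)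
    {r : (Fin d → ℝ) → ℝ}
    (hr : ∀ᵐ y ∂ν, |r y| ≤ |w (gridIdx (mesh N) (y β))| + D) :
    |∫ y, g y * r y ∂ν| ≤ √A * (√Q * mesh N + D) := by
  have hle : ∀ᵐ y ∂ν, ‖g y * r y‖ ≤ g y * (|w (gridIdx (mesh N) (y β))| + D) := by
    filter_upwards [hr] with y hy
    rw [Real.norm_eq_abs, abs_mul, abs_of_nonneg (hg0 y)]
    exact mul_le_mul_of_nonneg_left hy (hg0 y)
  refine (norm_integral_le_of_norm_le
    (integrable_mul_comp_gridIdx hν hg N β fun J => |w J| + D) hle).trans ?_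
  rw [integral_mul_comp_gridIdx hν hg N β fun J => |w J| + D]
  exact sum_mul_abs_add_le hD hA hw

theorem abs_integral_comp_gridIdx_le [IsFiniteMeasure ν] (hν : ∀ᵐ y ∂ν, y ∈ unitCube d)
    {β : Fin d} {b Q : ℝ} (hb : 0 ≤ b)
    (hslab : ∀ J ∈ Finset.range (N + 1), ν.real (slab N β J) ≤ b * mesh N) {w : ℕ → ℝ}
    (hw : ∑ J ∈ Finset.range (N + 1), w J ^ 2 ≤ Q * mesh N) :
    |∫ y, w (gridIdx (mesh N) (y β)) ∂ν| ≤ b * √Q * mesh N := by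
  have hone (J : ℕ) : ∫ _ in slab N β J, (1 : ℝ) ∂ν = ν.real (slab N β J) := by
    rw [setIntegral_const, smul_eq_mul, mul_one]
  have hsq : ∑ J ∈ Finset.range (N + 1), (∫ _ in slab N β J, (1 : ℝ) ∂ν) ^ 2 ≤
      b ^ 2 * mesh N := by
    simp only [hone]
    refine (Finset.sum_le_sum (g := fun _ => (b * mesh N) ^ 2) fun J hJ =>
      pow_le_pow_left₀ measureReal_nonneg (hslab J hJ) 2).trans_eq ?_
    rw [Finset.sum_const, Finset.card_range, nsmul_eq_mul, Nat.cast_succ]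
    linear_combination b ^ 2 * mesh N * succ_mul_mesh N
  have hmean := abs_integral_mul_le_of_sum_sq_le hν (integrable_const (1 : ℝ))
    (fun _ => zero_le_one) le_rfl hsq hw (r := fun y => w (gridIdx (mesh N) (y β)))
    (Eventually.of_forall fun y => (add_zero _).ge)
  simpa only [one_mul, add_zero, Real.sqrt_sq hb, mul_assoc] using hmean

end Slabs

/-! ### Kernel weights of the slabs -/

section Kernel

theorem gridIdx_mem_Icc_of_abs_sub_le {h s t : ℝ} (hh : 0 < h) (hs : 0 ≤ s) (ht : 0 ≤ t)
    (hst : |s - t| ≤ h) : gridIdx h s ∈ Finset.Icc (gridIdx h t - 1) (gridIdx h t + 1) := by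
  have hs' := (gridIdx_eq_iff hh hs _).1 rfl
  have ht' := (gridIdx_eq_iff hh ht _).1 rfl
  have hst' := abs_le.1 hst
  have hupper : (gridIdx h s : ℝ) < gridIdx h t + 2 :=
    lt_of_mul_lt_mul_right (by linarith [hs'.1, ht'.2]) hh.le
  have hlower : (gridIdx h t : ℝ) < gridIdx h s + 2 :=
    lt_of_mul_lt_mul_right (by linarith [hs'.2, ht'.1]) hh.le
  rw [Finset.mem_Icc, tsub_le_iff_right]
  exact ⟨Nat.lt_succ_iff.1 (by exact_mod_cast hlower), Nat.lt_succ_iff.1 (by exact_mod_cast hupper)⟩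

variable {d : ℕ} [NeZero d] {K : ℝ → ℝ} {M h t : ℝ}

theorem scaledKernel_nonneg (hK0 : ∀ u, 0 ≤ K u) (hh : 0 < h) (u : ℝ) : 0 ≤ scaledKernel K h u :=
  div_nonneg (hK0 _) hh.le

theorem scaledKernel_eq_zero (hKs : ∀ u, 1 < |u| → K u = 0) (hh : 0 < h) {u : ℝ} (hu : h < |u|) :
    scaledKernel K h u = 0 := by
  rw [scaledKernel, hKs, zero_div]
  rwa [abs_div, abs_of_pos hh, one_lt_div hh]

theorem setIntegral_scaledKernel_le {ν : Measure (Fin d → ℝ)} [IsFiniteMeasure ν]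
    (hν : ∀ᵐ y ∂ν, y ∈ unitCube d) (hK0 : ∀ u, 0 ≤ K u) (hKM : ∀ u, K u ≤ M)
    (hKs : ∀ u, 1 < |u| → K u = 0) (hh : 0 < h) (ht : 0 ≤ t) (N : ℕ) (β : Fin d) (J : ℕ) :
    ∫ y in slab N β J, scaledKernel K h (y 0 - t) ∂ν ≤
      M / h * ∑ k ∈ Finset.Icc (gridIdx h t - 1) (gridIdx h t + 1),
        ν.real (cell h (mesh N) 0 β (k, J)) := by
  set window := Finset.Icc (gridIdx h t - 1) (gridIdx h t + 1)
  have hM : 0 ≤ M / h := div_nonneg ((hK0 0).trans (hKM 0)) hh.le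
  have hcell : ∀ k, MeasurableSet (cell h (mesh N) 0 β (k, J)) := fun k => measurableSet_cell ..
  have hle : ∀ᵐ y ∂ν, (slab N β J).indicator (fun y => scaledKernel K h (y 0 - t)) y ≤
      ∑ k ∈ window, (cell h (mesh N) 0 β (k, J)).indicator (fun _ => M / h) y := by
    filter_upwards [hν] with y hy
    have hnonneg : ∀ k ∈ window,
        0 ≤ (cell h (mesh N) 0 β (k, J)).indicator (fun _ => M / h) y :=
      fun k _ => Set.indicator_nonneg (fun _ _ => hM) y
    by_cases hyJ : y ∈ slab N β J
    · rw [Set.indicator_of_mem hyJ]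
      rcases le_or_gt |y 0 - t| h with hnear | hfar
      · have hmem : y ∈ cell h (mesh N) 0 β (gridIdx h (y 0), J) := Prod.ext rfl hyJ
        refine (div_le_div_of_nonneg_right (hKM _) hh.le).trans ?_
        refine (Set.indicator_of_mem hmem fun _ => M / h).ge.trans ?_
        exact Finset.single_le_sum hnonneg (gridIdx_mem_Icc_of_abs_sub_le hh (hy 0).1 ht hnear)
      · rw [scaledKernel_eq_zero hKs hh hfar]
        exact Finset.sum_nonneg hnonneg
    · rw [Set.indicator_of_notMem hyJ]
      exact Finset.sum_nonneg hnonneg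
  have hint : ∀ k ∈ window,
      Integrable ((cell h (mesh N) 0 β (k, J)).indicator fun _ => M / h) ν :=
    fun k _ => (integrable_const _).indicator (hcell k)
  rw [← integral_indicator (measurableSet_slab N β J)]
  refine (integral_mono_of_nonneg (Eventually.of_forall fun y => Set.indicator_nonneg
    (fun y _ => scaledKernel_nonneg hK0 hh _) y) (integrable_finsetSum _ hint) hle).trans_eq ?_
  rw [integral_finsetSum _ hint, Finset.mul_sum]
  exact Finset.sum_congr rfl fun k _ => by
    rw [integral_indicator_const _ (hcell k), smul_eq_mul, mul_comm]

theorem sq_sum_le_of_card_le {ι : Type*} {s : Finset ι} {k : ℕ} (hs : s.card ≤ k) {f p : ι → ℝ}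
    {b : ℝ} (hp0 : ∀ i, 0 ≤ p i) (hp : ∀ i, p i ≤ b) :
    (∑ i ∈ s, f i) ^ 2 ≤ 2 * (k * b) ^ 2 + 2 * k * ∑ i ∈ s, (f i - p i) ^ 2 := by
  have hterm : ∀ i ∈ s, f i ^ 2 ≤ 2 * b ^ 2 + 2 * (f i - p i) ^ 2 := fun i _ => by
    nlinarith [sq_nonneg (f i - p i - p i), pow_le_pow_left₀ (hp0 i) (hp i) 2]
  have hk : (s.card : ℝ) ≤ k := Nat.cast_le.2 hs
  have : 0 ≤ ∑ i ∈ s, (f i - p i) ^ 2 := Finset.sum_nonneg fun _ _ => sq_nonneg _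
  calc (∑ i ∈ s, f i) ^ 2 ≤ s.card * ∑ i ∈ s, f i ^ 2 := sq_sum_le_card_mul_sum_sq
    _ ≤ s.card * (s.card * (2 * b ^ 2) + 2 * ∑ i ∈ s, (f i - p i) ^ 2) := by
        refine mul_le_mul_of_nonneg_left ((Finset.sum_le_sum hterm).trans_eq ?_) (Nat.cast_nonneg _)
        rw [Finset.sum_add_distrib, Finset.sum_const, nsmul_eq_mul, Finset.mul_sum]
    _ ≤ k * (k * (2 * b ^ 2) + 2 * ∑ i ∈ s, (f i - p i) ^ 2) := by gcongr
    _ = 2 * (k * b) ^ 2 + 2 * k * ∑ i ∈ s, (f i - p i) ^ 2 := by ring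

theorem card_Icc_pred_succ_le (k : ℕ) : (Finset.Icc (k - 1) (k + 1)).card ≤ 3 := by
  rw [Nat.card_Icc]
  omega

theorem Icc_gridIdx_subset_range {L : ℕ} (hh : 0 < h) (ht : t ≤ 1) (hL : gridIdx h 1 + 2 ≤ L) :
    Finset.Icc (gridIdx h t - 1) (gridIdx h t + 1) ⊆ Finset.range L := by
  have hmono : gridIdx h t ≤ gridIdx h 1 := Nat.floor_mono (div_le_div_of_nonneg_right ht hh.le)
  intro k hk
  have hk' := (Finset.mem_Icc.1 hk).2
  exact Finset.mem_range.2 (by omega)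

theorem sum_sq_window_le {ν π : Measure (Fin d → ℝ)} {C : ℝ} {N L : ℕ} {β : Fin d} (hh : 0 < h)
    (hπ : ∀ q, π.real (cell h (mesh N) 0 β q) ≤ C * (h * mesh N)) (hL : gridIdx h 1 + 2 ≤ L)
    (hcell : sqError ν π (Finset.range L ×ˢ Finset.range (N + 1)) (cell h (mesh N) 0 β) ≤
      h ^ 2 * mesh N) (ht : t ≤ 1) :
    ∑ J ∈ Finset.range (N + 1), (∑ k ∈ Finset.Icc (gridIdx h t - 1) (gridIdx h t + 1),
      ν.real (cell h (mesh N) 0 β (k, J))) ^ 2 ≤ 6 * (3 * C ^ 2 + 1) * h ^ 2 * mesh N := by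
  set window := Finset.Icc (gridIdx h t - 1) (gridIdx h t + 1)
  set A := cell h (mesh N) 0 β
  have hmean : ∀ J ∈ Finset.range (N + 1), (∑ k ∈ window, ν.real (A (k, J))) ^ 2 ≤
      2 * (3 * (C * (h * mesh N))) ^ 2 +
        2 * 3 * ∑ k ∈ window, (ν.real (A (k, J)) - π.real (A (k, J))) ^ 2 := fun J _ =>
    sq_sum_le_of_card_le (card_Icc_pred_succ_le _) (fun _ => measureReal_nonneg) fun k => hπ (k, J)
  have herr : ∑ J ∈ Finset.range (N + 1), ∑ k ∈ window,
      (ν.real (A (k, J)) - π.real (A (k, J))) ^ 2 ≤ h ^ 2 * mesh N := by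
    rw [Finset.sum_comm]
    refine le_trans ?_ ((Finset.sum_product _ _ _).symm.trans_le hcell)
    exact Finset.sum_le_sum_of_subset_of_nonneg (Icc_gridIdx_subset_range hh ht hL) fun _ _ _ =>
      Finset.sum_nonneg fun _ _ => sq_nonneg _
  refine (Finset.sum_le_sum hmean).trans ?_
  rw [Finset.sum_add_distrib, Finset.sum_const, Finset.card_range, nsmul_eq_mul, Nat.cast_succ,
    ← Finset.mul_sum]
  linear_combination 6 * herr + 18 * C ^ 2 * h ^ 2 * mesh N * succ_mul_mesh N

theorem sum_sq_setIntegral_scaledKernel_le {ν π : Measure (Fin d → ℝ)} [IsFiniteMeasure ν]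
    (hν : ∀ᵐ y ∂ν, y ∈ unitCube d) (hK0 : ∀ u, 0 ≤ K u) (hKM : ∀ u, K u ≤ M)
    (hKs : ∀ u, 1 < |u| → K u = 0) {C : ℝ} {N L : ℕ} {β : Fin d} (hh : 0 < h)
    (hπ : ∀ q, π.real (cell h (mesh N) 0 β q) ≤ C * (h * mesh N)) (hL : gridIdx h 1 + 2 ≤ L)
    (hcell : sqError ν π (Finset.range L ×ˢ Finset.range (N + 1)) (cell h (mesh N) 0 β) ≤
      h ^ 2 * mesh N) (ht : t ∈ Set.Icc (0 : ℝ) 1) :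
    ∑ J ∈ Finset.range (N + 1), (∫ y in slab N β J, scaledKernel K h (y 0 - t) ∂ν) ^ 2 ≤
      6 * M ^ 2 * (3 * C ^ 2 + 1) * mesh N := by
  have hweight : ∀ J ∈ Finset.range (N + 1),
      (∫ y in slab N β J, scaledKernel K h (y 0 - t) ∂ν) ^ 2 ≤
        (M / h) ^ 2 * (∑ k ∈ Finset.Icc (gridIdx h t - 1) (gridIdx h t + 1),
          ν.real (cell h (mesh N) 0 β (k, J))) ^ 2 := fun J _ => by
    rw [← mul_pow]
    exact pow_le_pow_left₀ (integral_nonneg fun y => scaledKernel_nonneg hK0 hh _)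
      (setIntegral_scaledKernel_le hν hK0 hKM hKs hh ht.1 N β J) 2
  refine (Finset.sum_le_sum hweight).trans ?_
  rw [← Finset.mul_sum]
  refine (mul_le_mul_of_nonneg_left (sum_sq_window_le hh hπ hL hcell ht.2)
    (sq_nonneg _)).trans_eq ?_
  field_simp

end Kernel

/-! ### Means of step functions with small increments -/

section Tail

variable {d : ℕ} {N : ℕ}

/-- The points whose `β`-th coordinate lies beyond the `J`-th interval of length `δ`. -/
def tailSet (δ : ℝ) (β : Fin d) (J : ℕ) : Set (Fin d → ℝ) :=
  {x | J < gridIdx δ (x β)}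

theorem measurableSet_tailSet (δ : ℝ) (β : Fin d) (J : ℕ) : MeasurableSet (tailSet δ β J) :=
  ((measurable_gridIdx δ).comp (measurable_pi_apply β)) measurableSet_Ioi

theorem comp_gridIdx_eq_add_sum_tailSet (φ : ℕ → ℝ) (β : Fin d) {y : Fin d → ℝ}
    (hy : y ∈ unitCube d) :
    φ (gridIdx (mesh N) (y β)) = φ 0 + ∑ J ∈ Finset.range N,
      (tailSet (mesh N) β J).indicator (fun _ => φ (J + 1) - φ J) y := by
  have hidx := Finset.mem_range_succ_iff.1 (gridIdx_mesh_mem_range N (hy β))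
  have hout : ∀ J ∈ Finset.range N, J ∉ Finset.range (gridIdx (mesh N) (y β)) →
      (tailSet (mesh N) β J).indicator (fun _ => φ (J + 1) - φ J) y = 0 := fun J _ hJ =>
    Set.indicator_of_notMem (fun h : y ∈ tailSet (mesh N) β J => hJ (Finset.mem_range.2 h)) _
  have hin : ∀ J ∈ Finset.range (gridIdx (mesh N) (y β)),
      (tailSet (mesh N) β J).indicator (fun _ => φ (J + 1) - φ J) y = φ (J + 1) - φ J :=
    fun J hJ => Set.indicator_of_mem (show y ∈ tailSet (mesh N) β J from Finset.mem_range.1 hJ) _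
  rw [← Finset.sum_subset (Finset.range_subset_range.2 hidx) hout, Finset.sum_congr rfl hin,
    Finset.sum_range_sub, add_sub_cancel]

theorem integral_comp_gridIdx_eq_add_sum_tailSet {ν : Measure (Fin d → ℝ)} [IsProbabilityMeasure ν]
    (hν : ∀ᵐ y ∂ν, y ∈ unitCube d) (φ : ℕ → ℝ) (β : Fin d) :
    ∫ y, φ (gridIdx (mesh N) (y β)) ∂ν = φ 0 + ∑ J ∈ Finset.range N,
      ν.real (tailSet (mesh N) β J) * (φ (J + 1) - φ J) := by
  have hint : ∀ J ∈ Finset.range N,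
      Integrable ((tailSet (mesh N) β J).indicator fun _ => φ (J + 1) - φ J) ν := fun J _ =>
    (integrable_const _).indicator (measurableSet_tailSet _ _ _)
  rw [integral_congr_ae (hν.mono fun y hy => comp_gridIdx_eq_add_sum_tailSet φ β hy),
    integral_add (integrable_const _) (integrable_finsetSum _ hint), integral_finsetSum _ hint,
    integral_const, probReal_univ, one_smul]
  exact congrArg (φ 0 + ·) <| Finset.sum_congr rfl fun J _ => by
    rw [integral_indicator_const _ (measurableSet_tailSet _ _ _), smul_eq_mul]

variable {ν π : Measure (Fin d → ℝ)} {f : ℝ → ℝ} {l : NNReal}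

theorem aestronglyMeasurable_comp_eval (hπ : ∀ᵐ y ∂π, y ∈ unitCube d)
    (hf : LipschitzOnWith l f (Set.Icc 0 1)) (β : Fin d) :
    AEStronglyMeasurable (fun y => f (y β)) π := by
  obtain ⟨g, hg, hfg⟩ := hf.extend_real
  exact (hg.continuous.comp (continuous_apply β)).aestronglyMeasurable.congr
    (hπ.mono fun y hy => (hfg (Set.Ico_subset_Icc_self (hy β))).symm)

variable [IsProbabilityMeasure π]

/-- Summation by parts: increments of order `H` make the error of a mean as small as that of a
single tail probability. -/
theorem abs_integral_comp_gridIdx_sub_le [IsProbabilityMeasure ν]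
    (hν : ∀ᵐ y ∂ν, y ∈ unitCube d) (hπ : ∀ᵐ y ∂π, y ∈ unitCube d) {β : Fin d} {φ : ℕ → ℝ}
    {V : ℝ}
    (hφ : ∀ J ∈ Finset.range N, |φ (J + 1) - φ J| ≤ l * mesh N)
    (htail : sqError ν π (Finset.range N) (tailSet (mesh N) β) ≤ V * (N + 1)) :
    |∫ y, φ (gridIdx (mesh N) (y β)) ∂ν - ∫ y, φ (gridIdx (mesh N) (y β)) ∂π| ≤ l * √V := by
  have hincr : ∑ J ∈ Finset.range N, (φ (J + 1) - φ J) ^ 2 ≤ l ^ 2 * mesh N := by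
    refine (Finset.sum_le_card_nsmul _ _ ((l * mesh N) ^ 2) fun J hJ =>
      sq_le_sq.2 ((hφ J hJ).trans (le_abs_self _))).trans ?_
    rw [Finset.card_range, nsmul_eq_mul]
    linear_combination l ^ 2 * mesh N * succ_mul_mesh N + sq_nonneg (l * mesh N)
  refine (Real.abs_le_sqrt ?_).trans_eq
    ((Real.sqrt_mul (sq_nonneg (l : ℝ)) V).trans (by rw [Real.sqrt_sq l.coe_nonneg]))
  rw [integral_comp_gridIdx_eq_add_sum_tailSet hν, integral_comp_gridIdx_eq_add_sum_tailSet hπ,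
    add_sub_add_left_eq_sub, ← Finset.sum_sub_distrib]
  simp only [← sub_mul]
  refine (Finset.sum_mul_sq_le_sq_mul_sq _ _ _).trans ?_
  refine (mul_le_mul htail hincr (Finset.sum_nonneg fun _ _ => sq_nonneg _)
    ((Finset.sum_nonneg fun _ _ => sq_nonneg _).trans htail)).trans_eq ?_
  linear_combination l ^ 2 * V * succ_mul_mesh N

theorem abs_integral_comp_node_le (hπ : ∀ᵐ y ∂π, y ∈ unitCube d)
    (hf : LipschitzOnWith l f (Set.Icc 0 1)) {β : Fin d} (hcenter : ∫ y, f (y β) ∂π = 0) (N : ℕ) :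
    |∫ y, f (gridIdx (mesh N) (y β) * mesh N) ∂π| ≤ l * mesh N := by
  have hnode : Integrable (fun y => f (gridIdx (mesh N) (y β) * mesh N)) π :=
    integrable_comp_of_ae_mem ((measurable_gridIdx (mesh N)).comp (measurable_pi_apply β))
      (hπ.mono fun y hy => gridIdx_mesh_mem_range N (hy β)) fun J => f (J * mesh N)
  have hbound : ∀ᵐ y ∂π, ‖f (y β) - f (gridIdx (mesh N) (y β) * mesh N)‖ ≤ l * mesh N :=
    hπ.mono fun y hy => abs_sub_comp_node_le hf N (hy β)
  have hdiff : Integrable (fun y => f (y β) - f (gridIdx (mesh N) (y β) * mesh N)) π :=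
    Integrable.of_bound ((aestronglyMeasurable_comp_eval hπ hf β).sub hnode.aestronglyMeasurable)
      _ hbound
  have hsub := integral_add hdiff hnode
  simp only [sub_add_cancel, hcenter] at hsub
  rw [← abs_neg, ← eq_neg_of_add_eq_zero_left hsub.symm]
  exact (norm_integral_le_of_norm_le_const hbound).trans_eq (by rw [probReal_univ, mul_one])

theorem abs_sub_comp_succ_node_le (hf : LipschitzOnWith l f (Set.Icc 0 1)) {J : ℕ}
    (hJ : J ∈ Finset.range N) :
    |f ((J + 1 : ℕ) * mesh N) - f (J * mesh N)| ≤ l * mesh N := by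
  have hmem : ∀ k ≤ N + 1, (k : ℝ) * mesh N ∈ Set.Icc (0 : ℝ) 1 := fun k hk =>
    ⟨node_nonneg N k, (mul_le_mul_of_nonneg_right (Nat.cast_le.2 hk) (mesh_pos N).le).trans_eq
      (by rw [Nat.cast_succ, succ_mul_mesh])⟩
  have hJN := Finset.mem_range.1 hJ
  refine (hf.dist_le_mul _ (hmem _ (by omega)) _ (hmem _ (by omega))).trans_eq ?_
  rw [Real.dist_eq, Nat.cast_succ, ← sub_mul, add_sub_cancel_left, one_mul, abs_of_pos (mesh_pos N)]

theorem abs_integral_comp_node_le_of_sqError_le [IsProbabilityMeasure ν]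
    (hν : ∀ᵐ y ∂ν, y ∈ unitCube d) (hπ : ∀ᵐ y ∂π, y ∈ unitCube d)
    (hf : LipschitzOnWith l f (Set.Icc 0 1)) {β : Fin d} (hcenter : ∫ y, f (y β) ∂π = 0) {V : ℝ}
    (htail : sqError ν π (Finset.range N) (tailSet (mesh N) β) ≤ V * (N + 1)) :
    |∫ y, f (gridIdx (mesh N) (y β) * mesh N) ∂ν| ≤ l * mesh N + l * √V := by
  have hπmean := abs_integral_comp_node_le hπ hf hcenter N
  have hdiff := abs_integral_comp_gridIdx_sub_le hν hπ (φ := fun J => f (J * mesh N))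
    (fun J => abs_sub_comp_succ_node_le hf) htail
  exact (sub_le_iff_le_add'.1 (abs_sub_abs_le_abs_sub _ _)).trans (add_le_add hπmean hdiff)

end Tail

/-! ### The bias at regular samples -/

section Bias

variable {d n N : ℕ} {x : ℕ → Fin d → ℝ} {μ : Fin d → Measure ℝ}
  {a : SplineCoeff d N} {β : Fin d} {m : Fin d → ℝ → ℝ}

theorem pilotComponent_sub_eq (hn : 0 < n) (hx : ∀ i, x i ∈ unitCube d) {w : ℕ → ℝ} {κ : ℝ}
    (hw : ∀ J, nodeError μ m a β J = w J + κ) {y : Fin d → ℝ} (hy : y ∈ unitCube d) :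
    pilotComponent μ n x a β (y β) - m β (y β) =
      w (gridIdx (mesh N) (y β)) + (m β (gridIdx (mesh N) (y β) * mesh N) - m β (y β)) -
        (∫ z, w (gridIdx (mesh N) (z β)) ∂empirical n x +
          ∫ z, m β (gridIdx (mesh N) (z β) * mesh N) ∂empirical n x) := by
  have hcomp : ∀ z ∈ unitCube d, splineComponent μ a β (z β) =
      w (gridIdx (mesh N) (z β)) + m β (gridIdx (mesh N) (z β) * mesh N) + κ := fun z hz => by
    rw [splineComponent_node μ a β (hz β).1]
    exact (sub_eq_iff_eq_add'.1 (hw _)).trans (by ring)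
  have : IsProbabilityMeasure (empirical n x) := isProbabilityMeasure_empirical hn x
  have hmean : (n : ℝ)⁻¹ * ∑ i ∈ Finset.range n, splineComponent μ a β (x i β) =
      ∫ z, w (gridIdx (mesh N) (z β)) ∂empirical n x +
        ∫ z, m β (gridIdx (mesh N) (z β) * mesh N) ∂empirical n x + κ := by
    rw [Finset.sum_congr rfl fun i _ => hcomp (x i) (hx i),
      ← integral_empirical n x fun z =>
        w (gridIdx (mesh N) (z β)) + m β (gridIdx (mesh N) (z β) * mesh N) + κ,
      integral_add (integrable_empirical _ _ _) (integrable_const κ),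
      integral_add (integrable_empirical _ _ _) (integrable_empirical _ _ _),
      integral_const, probReal_univ, one_smul]
  rw [pilotComponent, hmean, hcomp y hy]
  ring

variable [NeZero d]

theorem biasPart_eq_integral (K : ℝ → ℝ) (h t : ℝ) :
    biasPart K h m μ n x a β t =
      ∫ y, scaledKernel K h (y 0 - t) * (pilotComponent μ n x a β (y β) - m β (y β))
        ∂empirical n x := by
  rw [integral_empirical, biasPart]

/-- A sample whose relative frequencies are close enough to the probabilities under `π` for the
bias of the `β`-th pilot component to be small: those of the cells of side `H` for the least squares
problem, those of the cells of sides `h` and `H` for the kernel weights, and those of the tail sets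
for the empirical centring. -/
structure RegularSample (π : Measure (Fin d → ℝ)) (c h V : ℝ) (N : ℕ) (β : Fin d) (n : ℕ)
    (x : ℕ → Fin d → ℝ) : Prop where
  mem_unitCube : ∀ i, x i ∈ unitCube d
  gram_le : sqError (empirical n x) π (gramIdx d N) (gramCell N) ≤ (c * mesh N / 2) ^ 2
  window_le : sqError (empirical n x) π (Finset.range (N + 1) ×ˢ Finset.range (N + 1))
    (cell h (mesh N) 0 β) ≤ h ^ 2 * mesh N
  tail_le : sqError (empirical n x) π (Finset.range N) (tailSet (mesh N) β) ≤ V * (N + 1)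

/-- The constant in the bound for the bias at regular samples. -/
def biasConst (d : ℕ) (l : NNReal) (c C M : ℝ) : ℝ :=
  √(6 * M ^ 2 * (3 * C ^ 2 + 1)) * ((1 + 2 * C) * √(8 * (d * l) ^ 2 / c) + 2 * l)

namespace RegularSample

variable {π : Measure (Fin d → ℝ)} {c C h V : ℝ} {l : NNReal} {c₀ : ℝ}

theorem ae_mem_unitCube (hreg : RegularSample π c h V N β n x) :
    ∀ᵐ y ∂empirical n x, y ∈ unitCube d :=
  ae_empirical n (measurableSet_unitCube d) hreg.mem_unitCube

variable [IsProbabilityMeasure π]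

theorem exists_nodeError_eq (hreg : RegularSample π c h V N β n x) (hπ : QuasiUniform c C π)
    (hμ : ∀ α, μ α = π.map fun x => x α) (hn : 0 < n)
    (hm : ∀ α, LipschitzOnWith l (m α) (Set.Icc 0 1))
    (ha : IsLeastSquares μ n x (fun i => additiveMean c₀ m (x i)) a) :
    ∃ w : ℕ → ℝ, ∑ J ∈ Finset.range (N + 1), w J ^ 2 ≤ 8 * (d * l) ^ 2 / c * mesh N ∧
      ∃ κ, ∀ J, nodeError μ m a β J = w J + κ := by
  have : ∀ α, IsFiniteMeasure (μ α) := fun α => by rw [hμ]; infer_instance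
  have hnorm : ∀ α, ∀ J ∈ Finset.range (N + 1), 0 < l2Norm (μ α) (stepFn N J) := fun α _ hJ =>
    l2Norm_stepFn_pos hπ.pos (by rw [hμ]; exact hπ.map_eval_lower α) hJ
  obtain ⟨w, hlen, herr⟩ := IsLeastSquares.exists_sqLen_le hnorm hn hreg.mem_unitCube hm ha hπ.pos
    fun _ => hπ.le_integral_additiveStep_sq_of_sqError_le hreg.ae_mem_unitCube hreg.gram_le
  exact ⟨w β, (sum_sq_le_sqLen N w β).trans hlen, herr β⟩

theorem abs_pilotComponent_sub_le (hreg : RegularSample π c h V N β n x)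
    (hπ : QuasiUniform c C π) (hn : 0 < n) (hm : LipschitzOnWith l (m β) (Set.Icc 0 1))
    (hcenter : ∫ y, m β (y β) ∂π = 0) {w : ℕ → ℝ} {κ Q : ℝ}
    (hw : ∑ J ∈ Finset.range (N + 1), w J ^ 2 ≤ Q * mesh N)
    (hκ : ∀ J, nodeError μ m a β J = w J + κ) {y : Fin d → ℝ} (hy : y ∈ unitCube d) :
    |pilotComponent μ n x a β (y β) - m β (y β)| ≤
      |w (gridIdx (mesh N) (y β))| + ((2 * C * √Q + 2 * l) * mesh N + l * √V) := by
  have : IsProbabilityMeasure (empirical n x) := isProbabilityMeasure_empirical hn x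
  have hnode : |m β (gridIdx (mesh N) (y β) * mesh N) - m β (y β)| ≤ l * mesh N :=
    (abs_sub_comm _ _).trans_le (abs_sub_comp_node_le hm N (hy β))
  have hmean := abs_integral_comp_gridIdx_le hreg.ae_mem_unitCube
    (mul_nonneg zero_le_two hπ.upper_pos.le)
    (fun _ => hπ.real_slab_le hreg.gram_le β) hw
  have hcentred := abs_integral_comp_node_le_of_sqError_le hreg.ae_mem_unitCube
    hπ.ae_mem_unitCube hm hcenter hreg.tail_le
  rw [pilotComponent_sub_eq hn hreg.mem_unitCube hκ hy]
  refine (abs_sub _ _).trans ?_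
  linarith [abs_add_le (w (gridIdx (mesh N) (y β)))
      (m β (gridIdx (mesh N) (y β) * mesh N) - m β (y β)),
    abs_add_le (∫ z, w (gridIdx (mesh N) (z β)) ∂empirical n x)
      (∫ z, m β (gridIdx (mesh N) (z β) * mesh N) ∂empirical n x)]

theorem abs_biasPart_le (hreg : RegularSample π c h V N β n x) (hπ : QuasiUniform c C π)
    (hμ : ∀ α, μ α = π.map fun x => x α) (hn : 0 < n)
    (hm : ∀ α, LipschitzOnWith l (m α) (Set.Icc 0 1)) (hcenter : ∫ y, m β (y β) ∂π = 0)
    (ha : IsLeastSquares μ n x (fun i => additiveMean c₀ m (x i)) a) (hβ : β ≠ 0)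
    {K : ℝ → ℝ} {M : ℝ} (hK0 : ∀ u, 0 ≤ K u) (hKM : ∀ u, K u ≤ M) (hKs : ∀ u, 1 < |u| → K u = 0)
    (hh : 0 < h) (hwindow : gridIdx h 1 + 2 ≤ N + 1) {t : ℝ} (ht : t ∈ Set.Icc (0 : ℝ) 1) :
    |biasPart K h m μ n x a β t| ≤ biasConst d l c C M * (mesh N + √V) := by
  have hC := hπ.upper_pos
  have hH := mesh_pos N
  have hweights := sum_sq_setIntegral_scaledKernel_le hreg.ae_mem_unitCube hK0 hKM hKs hh
    (hπ.real_cell_le hh hH hβ.symm) hwindow hreg.window_le ht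
  obtain ⟨w, hw, κ, hκ⟩ := hreg.exists_nodeError_eq hπ hμ hn hm ha
  rw [biasPart_eq_integral]
  refine (abs_integral_mul_le_of_sum_sq_le hreg.ae_mem_unitCube (integrable_empirical n x _)
    (fun y => scaledKernel_nonneg hK0 hh _) (by positivity) hweights hw
    (hreg.ae_mem_unitCube.mono fun y hy =>
      hreg.abs_pilotComponent_sub_le hπ hn (hm β) hcenter hw hκ hy)).trans ?_
  rw [biasConst, mul_assoc √_]
  refine mul_le_mul_of_nonneg_left ?_ (Real.sqrt_nonneg _)
  have hrest : 0 ≤ ((1 + 2 * C) * √(8 * (d * l) ^ 2 / c) + l) * √V := by positivity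
  linarith

end RegularSample

end Bias

/-! ### Rates -/

theorem tendsto_natCast_rpow {y : ℝ} (hy : 0 < y) :
    Tendsto (fun n : ℕ => (n : ℝ) ^ y) atTop atTop :=
  (tendsto_rpow_atTop hy).comp tendsto_natCast_atTop_atTop

theorem tendsto_natCast_rpow_neg {y : ℝ} (hy : 0 < y) :
    Tendsto (fun n : ℕ => (n : ℝ) ^ (-y)) atTop (𝓝 0) :=
  (tendsto_rpow_neg_atTop hy).comp tendsto_natCast_atTop_atTop

theorem tendsto_log_natCast : Tendsto (fun n : ℕ => Real.log n) atTop atTop :=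
  Real.tendsto_log_atTop.comp tendsto_natCast_atTop_atTop

theorem eventually_natCast_pos : ∀ᶠ n : ℕ in atTop, (0 : ℝ) < n :=
  (eventually_gt_atTop 0).mono fun _ hn => Nat.cast_pos.2 hn

theorem eventually_mul_log_le_rpow {C s : ℝ} (hC : 0 < C) (hs : 0 < s) :
    ∀ᶠ n : ℕ in atTop, C * Real.log n ≤ (n : ℝ) ^ s := by
  filter_upwards [((isLittleO_log_rpow_atTop hs).comp_tendsto tendsto_natCast_atTop_atTop).bound
    (inv_pos.2 hC)] with n hlog
  simp only [Function.comp_apply, Real.norm_eq_abs, abs_of_nonneg (Real.log_natCast_nonneg n),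
    abs_of_nonneg (Real.rpow_nonneg n.cast_nonneg s)] at hlog
  exact (le_inv_mul_iff₀ hC).1 hlog

section Orders

variable {N : ℕ → ℕ} {h : ℕ → ℝ}

/-- Any exponent slightly above `2 / 5` absorbs the logarithm. -/
theorem KnotOrder.eventually_le (hN : KnotOrder N) :
    ∀ᶠ n : ℕ in atTop, (N n : ℝ) + 1 ≤ (n : ℝ) ^ (41 / 100 : ℝ) := by
  obtain ⟨_, C, _, hC, hev⟩ := hN
  filter_upwards [hev, eventually_mul_log_le_rpow (mul_pos two_pos hC) (s := 1 / 100) (by norm_num),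
    (tendsto_natCast_rpow (y := 41 / 100) (by norm_num)).eventually_ge_atTop 2,
    eventually_natCast_pos] with n hNn hlog hbig hn
  have hsplit : (n : ℝ) ^ (41 / 100 : ℝ) = (n : ℝ) ^ (2 / 5 : ℝ) * (n : ℝ) ^ (1 / 100 : ℝ) := by
    rw [← Real.rpow_add hn]; norm_num
  have hhalf := mul_le_mul_of_nonneg_left hlog (Real.rpow_nonneg hn.le (2 / 5))
  linarith [hNn.2]

theorem KnotOrder.eventually_ge (hN : KnotOrder N) :
    ∀ᶠ n : ℕ in atTop, (n : ℝ) ^ (2 / 5 : ℝ) ≤ N n := by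
  obtain ⟨c, _, hc, _, hev⟩ := hN
  filter_upwards [hev, (tendsto_log_natCast.const_mul_atTop hc).eventually_ge_atTop 1]
    with n hNn hlog
  refine le_trans ?_ hNn.1
  rw [mul_left_comm]
  exact le_mul_of_one_le_right (Real.rpow_nonneg n.cast_nonneg _) hlog

theorem KnotOrder.tendsto_rpow_mul_mesh (hN : KnotOrder N) :
    Tendsto (fun n : ℕ => (n : ℝ) ^ (2 / 5 : ℝ) * mesh (N n)) atTop (𝓝 0) := by
  obtain ⟨c, _, hc, _, hev⟩ := hN
  have hlim : Tendsto (fun n : ℕ => (c * Real.log n)⁻¹) atTop (𝓝 0) :=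
    (tendsto_log_natCast.const_mul_atTop hc).inv_tendsto_atTop
  refine tendsto_of_tendsto_of_tendsto_of_le_of_le' tendsto_const_nhds hlim
    (Eventually.of_forall fun n => mul_nonneg (by positivity) (mesh_pos _).le) ?_
  filter_upwards [hev, tendsto_log_natCast.eventually_gt_atTop 0] with n hNn hlog
  rw [mesh, mul_one_div, div_le_iff₀ (by positivity), inv_mul_eq_div, le_div_iff₀ (by positivity)]
  linarith [hNn.1]

theorem KnotOrder.tendsto_rate_div (hN : KnotOrder N) :
    Tendsto (fun n : ℕ => ((n : ℝ) ^ (-(1 / 2) : ℝ) + mesh (N n)) / (n : ℝ) ^ (-(2 / 5) : ℝ))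
      atTop (𝓝 0) := by
  have hsum := (tendsto_natCast_rpow_neg (y := 1 / 10) (by norm_num)).add hN.tendsto_rpow_mul_mesh
  rw [add_zero] at hsum
  refine hsum.congr' (eventually_natCast_pos.mono fun n hn => ?_)
  beta_reduce
  rw [add_div, ← Real.rpow_sub hn, Real.rpow_neg hn.le (2 / 5), div_inv_eq_mul, mul_comm (mesh _)]
  norm_num

theorem KnotOrder.tendsto_gram_rate (hN : KnotOrder N) :
    Tendsto (fun n : ℕ => (((N n : ℝ) + 1) ^ 2) ^ (1 / 10 : ℝ) / n / mesh (N n) ^ 2)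
      atTop (𝓝 0) := by
  refine tendsto_of_tendsto_of_tendsto_of_le_of_le' tendsto_const_nhds
    (tendsto_natCast_rpow_neg (y := 98 / 1000) (by norm_num))
    (Eventually.of_forall fun n => by positivity) ?_
  filter_upwards [hN.eventually_le, eventually_natCast_pos] with n hNn hn
  calc (((N n : ℝ) + 1) ^ 2) ^ (1 / 10 : ℝ) / n / mesh (N n) ^ 2
      = (((N n : ℝ) + 1) ^ 2) ^ (1 / 10 : ℝ) * ((N n : ℝ) + 1) ^ 2 / n := by
        rw [mesh]; field_simp
    _ ≤ (((n : ℝ) ^ (41 / 100 : ℝ)) ^ 2) ^ (1 / 10 : ℝ) * ((n : ℝ) ^ (41 / 100 : ℝ)) ^ 2 / n := by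
        gcongr
    _ = (n : ℝ) ^ (-(98 / 1000) : ℝ) := by
        rw [← Real.rpow_natCast, ← Real.rpow_mul hn.le, ← Real.rpow_mul hn.le,
          ← Real.rpow_add hn, ← Real.rpow_sub_one hn.ne']
        norm_num

theorem tendsto_window_rate (hN : KnotOrder N) (hh : BandwidthOrder h) :
    Tendsto (fun n : ℕ => (((N n : ℝ) + 1) ^ 2) ^ (1 / 10 : ℝ) / n / (h n ^ 2 * mesh (N n)))
      atTop (𝓝 0) := by
  obtain ⟨c, _, hc, _, hev⟩ := hh
  have hlim := (tendsto_natCast_rpow_neg (y := 108 / 1000) (by norm_num)).div_const (c ^ 2)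
  rw [zero_div] at hlim
  refine tendsto_of_tendsto_of_tendsto_of_le_of_le' tendsto_const_nhds hlim
    (Eventually.of_forall fun n => have := mesh_pos (N n); by positivity) ?_
  filter_upwards [hN.eventually_le, hev, eventually_natCast_pos] with n hNn hhn hn
  have : 0 < c * (n : ℝ) ^ (-(1 / 5) : ℝ) := mul_pos hc (Real.rpow_pos_of_pos hn _)
  calc (((N n : ℝ) + 1) ^ 2) ^ (1 / 10 : ℝ) / n / (h n ^ 2 * mesh (N n))
      = (((N n : ℝ) + 1) ^ 2) ^ (1 / 10 : ℝ) * ((N n : ℝ) + 1) / n / h n ^ 2 := by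
        rw [mesh]; field_simp
    _ ≤ (((n : ℝ) ^ (41 / 100 : ℝ)) ^ 2) ^ (1 / 10 : ℝ) * (n : ℝ) ^ (41 / 100 : ℝ) / n /
        (c * (n : ℝ) ^ (-(1 / 5) : ℝ)) ^ 2 := by
        gcongr
        exact hhn.1
    _ = (n : ℝ) ^ (-(108 / 1000) : ℝ) / c ^ 2 := by
        rw [mul_pow, mul_comm (c ^ 2), ← div_div, ← Real.rpow_natCast, ← Real.rpow_natCast,
          ← Real.rpow_mul hn.le, ← Real.rpow_mul hn.le, ← Real.rpow_mul hn.le, ← Real.rpow_add hn,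
          ← Real.rpow_sub_one hn.ne', ← Real.rpow_sub hn]
        norm_num

theorem BandwidthOrder.eventually_pos (hh : BandwidthOrder h) : ∀ᶠ n : ℕ in atTop, 0 < h n := by
  obtain ⟨c, _, hc, _, hev⟩ := hh
  filter_upwards [hev, eventually_natCast_pos] with n hhn hn
  exact (mul_pos hc (Real.rpow_pos_of_pos hn _)).trans_le hhn.1

theorem eventually_gridIdx_le (hN : KnotOrder N) (hh : BandwidthOrder h) :
    ∀ᶠ n : ℕ in atTop, gridIdx (h n) 1 + 2 ≤ N n + 1 := by
  have hpos := hh.eventually_pos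
  obtain ⟨c, _, hc, _, hev⟩ := hh
  filter_upwards [hN.eventually_ge, hev, hpos, eventually_natCast_pos,
    (tendsto_natCast_rpow (y := 1 / 5) (by norm_num)).eventually_ge_atTop (1 / c + 1)]
    with n hNn hhn hhpos hn hbig
  have hcpos : 0 < 1 / c := by positivity
  have hsq : (n : ℝ) ^ (2 / 5 : ℝ) = (n : ℝ) ^ (1 / 5 : ℝ) * (n : ℝ) ^ (1 / 5 : ℝ) := by
    rw [← Real.rpow_add hn]; norm_num
  have hinv : 1 / h n ≤ 1 / c * (n : ℝ) ^ (1 / 5 : ℝ) := by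
    rw [Real.rpow_neg hn.le] at hhn
    refine (one_div_le_one_div_of_le (by positivity) hhn.1).trans_eq ?_
    field_simp
  have hidx : (gridIdx (h n) 1 : ℝ) ≤ 1 / h n := Nat.floor_le (by positivity)
  have hlt : (gridIdx (h n) 1 : ℝ) + 1 ≤ N n := by nlinarith
  have hltnat : gridIdx (h n) 1 + 1 ≤ N n := by exact_mod_cast hlt
  omega

end Orders

/-! ### Probabilities of irregular samples -/

section Irregular

variable {Ω : Type*} [MeasurableSpace Ω] {P : Measure Ω} {d : ℕ}
  {X : ℕ → Ω → (Fin d → ℝ)} {π : Measure (Fin d → ℝ)} {K r : ℝ} {N : ℕ → ℕ} {h : ℕ → ℝ}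

theorem ae_forall_mem_of_map_eq (hX : ∀ i, Measurable (X i))
    (hlaw : ∀ i, P.map (X i) = π) {A : Set (Fin d → ℝ)} (hA : ∀ᵐ y ∂π, y ∈ A) :
    ∀ᵐ ω ∂P, ∀ i, X i ω ∈ A :=
  ae_all_iff.2 fun i => ae_of_ae_map (hX i).aemeasurable (by rwa [hlaw])

theorem GeometricEventDecay.mixConst_pos (hdec : GeometricEventDecay P X K r) {θ : ℝ} (hθ : 0 < θ) :
    0 < mixConst K r θ :=
  div_pos (mul_pos two_pos (Real.rpow_pos_of_pos hdec.const_pos θ))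
    (sub_pos.2 (Real.rpow_lt_one hdec.rate_pos.le hdec.rate_lt_one hθ))

variable [IsProbabilityMeasure P]

namespace GeometricEventDecay

theorem measure_gram_le (hdec : GeometricEventDecay P X K r) (hX : ∀ i, Measurable (X i))
    (hlaw : ∀ i, P.map (X i) = π) {θ : ℝ} (hθ0 : 0 < θ) (hθ1 : θ ≤ 1) {n : ℕ} (hn : 0 < n) {δ : ℝ}
    (hδ : 0 < δ) (N : ℕ) :
    P {ω | δ < sqError (empirical n (X · ω)) π (gramIdx d N) (gramCell N)} ≤
      ENNReal.ofReal (d ^ 2 * (mixConst K r θ * (((N : ℝ) + 1) ^ 2) ^ θ / n) / δ) := by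
  have hbound := hdec.measure_lt_sum_sqError_le hX hlaw
    (s := Finset.range (N + 1) ×ˢ Finset.range (N + 1)) (t := Finset.univ)
    (A := fun k : Fin d × Fin d => cell (mesh N) (mesh N) k.1 k.2)
    (fun _ => measurableSet_cell _ _ _ _) (fun _ => pairwiseDisjoint_cell _ _ _ _ _) hθ0 hθ1 hn hδ
  simp only [Finset.card_product, Finset.card_range, Finset.card_univ, Fintype.card_prod,
    Fintype.card_fin, ← sq, Nat.cast_pow, Nat.cast_succ] at hbound
  simpa only [sqError, gramIdx, gramCell, Finset.sum_product (Finset.univ : Finset (Fin d × Fin d))]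
    using hbound

theorem measure_window_le (hdec : GeometricEventDecay P X K r) (hX : ∀ i, Measurable (X i))
    (hlaw : ∀ i, P.map (X i) = π) {θ : ℝ} (hθ0 : 0 < θ) (hθ1 : θ ≤ 1) {n : ℕ} (hn : 0 < n) {η : ℝ}
    (hη : 0 < η) (δ ε : ℝ) (α β : Fin d) (L : ℕ) :
    P {ω | η < sqError (empirical n (X · ω)) π
        (Finset.range (L + 1) ×ˢ Finset.range (L + 1)) (cell δ ε α β)} ≤
      ENNReal.ofReal (mixConst K r θ * (((L : ℝ) + 1) ^ 2) ^ θ / n / η) := by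
  simpa [← sq] using hdec.measure_lt_sum_sqError_le hX hlaw
    (s := Finset.range (L + 1) ×ˢ Finset.range (L + 1)) (t := {()}) (A := fun _ => cell δ ε α β)
    (fun _ => measurableSet_cell _ _ _ _) (fun _ => pairwiseDisjoint_cell _ _ _ _ _) hθ0 hθ1 hn hη

theorem measure_tail_le (hdec : GeometricEventDecay P X K r) (hX : ∀ i, Measurable (X i))
    (hlaw : ∀ i, P.map (X i) = π) {θ : ℝ} (hθ0 : 0 < θ) (hθ1 : θ ≤ 1) {n : ℕ} (hn : 0 < n) {V : ℝ}
    (hV : 0 < V) (β : Fin d) (N : ℕ) :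
    P {ω | V / n * (N + 1) <
        sqError (empirical n (X · ω)) π (Finset.range N) (tailSet (mesh N) β)} ≤
      ENNReal.ofReal (mixConst K r θ / V) := by
  have : (0 : ℝ) < n := Nat.cast_pos.2 hn
  have hbound := hdec.measure_lt_sum_sqError_le hX hlaw (s := {()}) (t := Finset.range N)
    (A := fun J _ => tailSet (mesh N) β J) (fun _ _ => measurableSet_tailSet _ _ _) (by simp)
    hθ0 hθ1 hn (δ := V / n * (N + 1)) (by positivity)
  simp only [sqError, Finset.sum_singleton, Finset.card_singleton, Finset.card_range, Nat.cast_one,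
    Real.one_rpow, mul_one] at hbound
  refine hbound.trans (ENNReal.ofReal_le_ofReal ?_)
  have hratio : (N : ℝ) / (N + 1) ≤ 1 := div_le_one_of_le₀ (by linarith) (by positivity)
  have hpos := hdec.mixConst_pos hθ0
  calc N * (mixConst K r θ / n) / (V / n * (N + 1)) = mixConst K r θ / V * (N / (N + 1)) := by
        field_simp
    _ ≤ mixConst K r θ / V := mul_le_of_le_one_right (by positivity) hratio

end GeometricEventDecay

variable [NeZero d] {c C : ℝ}

theorem GeometricEventDecay.measure_not_regularSample_le
    (hdec : GeometricEventDecay P X K r) (hX : ∀ i, Measurable (X i))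
    (hlaw : ∀ i, P.map (X i) = π) (hπ : QuasiUniform c C π) {θ : ℝ} (hθ0 : 0 < θ) (hθ1 : θ ≤ 1)
    {n : ℕ} (hn : 0 < n) {h₀ : ℝ} (hh₀ : 0 < h₀) {V : ℝ} (hV : 0 < V) (N : ℕ) (β : Fin d) :
    P {ω | ¬ RegularSample π c h₀ (V / n) N β n (X · ω)} ≤
      ENNReal.ofReal (d ^ 2 * (mixConst K r θ * (((N : ℝ) + 1) ^ 2) ^ θ / n) /
          (c * mesh N / 2) ^ 2) +
        (ENNReal.ofReal (mixConst K r θ * (((N : ℝ) + 1) ^ 2) ^ θ / n / (h₀ ^ 2 * mesh N)) +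
          ENNReal.ofReal (mixConst K r θ / V)) := by
  have hH := mesh_pos N
  have hc := hπ.pos
  have hcube : P {ω | ¬ ∀ i, X i ω ∈ unitCube d} = 0 :=
    ae_iff.1 (ae_forall_mem_of_map_eq hX hlaw hπ.ae_mem_unitCube)
  have hgram := hdec.measure_gram_le hX hlaw hθ0 hθ1 hn
    (by positivity : 0 < (c * mesh N / 2) ^ 2) N
  have hwindow := hdec.measure_window_le hX hlaw hθ0 hθ1 hn (by positivity : 0 < h₀ ^ 2 * mesh N)
    h₀ (mesh N) 0 β N
  have htail := hdec.measure_tail_le hX hlaw hθ0 hθ1 hn hV β N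
  set gramBad := {ω | _ < sqError (empirical n (X · ω)) π (gramIdx d N) (gramCell N)}
  set windowBad := {ω | h₀ ^ 2 * mesh N < _}
  set tailBad := {ω | V / n * (N + 1) < _}
  have hsub : {ω | ¬ RegularSample π c h₀ (V / n) N β n (X · ω)} ⊆
      {ω | ¬ ∀ i, X i ω ∈ unitCube d} ∪ (gramBad ∪ (windowBad ∪ tailBad)) := fun ω hω => by
    by_contra hnot
    simp only [Set.mem_union, not_or] at hnot
    exact hω ⟨not_not.1 hnot.1, not_lt.1 hnot.2.1, not_lt.1 hnot.2.2.1, not_lt.1 hnot.2.2.2⟩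
  refine (measure_mono hsub).trans ((measure_union_le _ _).trans ?_)
  rw [hcube, zero_add]
  exact (measure_union_le _ _).trans
    (add_le_add hgram ((measure_union_le _ _).trans (add_le_add hwindow htail)))

theorem GeometricEventDecay.eventually_measure_not_regularSample_le
    (hdec : GeometricEventDecay P X K r) (hX : ∀ i, Measurable (X i))
    (hlaw : ∀ i, P.map (X i) = π) (hπ : QuasiUniform c C π) (hh : BandwidthOrder h)
    (hN : KnotOrder N) (β : Fin d) {ε : ℝ} (hε : 0 < ε) :
    ∀ᶠ n : ℕ in atTop, P {ω | ¬ RegularSample π c (h n) (2 * mixConst K r (1 / 10) / ε / n) (N n) β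
      n (X · ω)} ≤ ENNReal.ofReal ε := by
  have hmix := hdec.mixConst_pos (θ := 1 / 10) (by norm_num)
  have hc := hπ.pos
  have hgram := hN.tendsto_gram_rate.const_mul (d ^ 2 * mixConst K r (1 / 10) * (2 / c) ^ 2)
  have hwindow := (tendsto_window_rate hN hh).const_mul (mixConst K r (1 / 10))
  rw [mul_zero] at hgram hwindow
  have hquarter : 0 < ε / 4 := by positivity
  filter_upwards [hgram.eventually_le_const hquarter, hwindow.eventually_le_const hquarter,
    hh.eventually_pos, eventually_gt_atTop 0] with n hgramn hwindown hhn hn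
  have hH := mesh_pos (N n)
  have hbound := hdec.measure_not_regularSample_le hX hlaw hπ (θ := 1 / 10) (by norm_num)
    (by norm_num) hn hhn (by positivity : 0 < 2 * mixConst K r (1 / 10) / ε) (N n) β
  refine hbound.trans ?_
  rw [← ENNReal.ofReal_add (by positivity) (by positivity),
    ← ENNReal.ofReal_add (by positivity) (by positivity)]
  refine ENNReal.ofReal_le_ofReal ?_
  have htail : mixConst K r (1 / 10) / (2 * mixConst K r (1 / 10) / ε) = ε / 2 := by field_simp
  calc _ ≤ ε / 4 + (ε / 4 + ε / 2) :=
        add_le_add (le_of_eq_of_le (by field_simp) hgramn)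
          (add_le_add (le_of_eq_of_le (by ring) hwindown) htail.le)
    _ = ε := by ring

theorem biasConst_nonneg (d : ℕ) (l : NNReal) (c M : ℝ) (hC : 0 ≤ C) : 0 ≤ biasConst d l c C M := by
  rw [biasConst]
  positivity

theorem isBigOp_iSup_biasPart (hX : ∀ i, Measurable (X i)) (hdec : GeometricEventDecay P X K r)
    (hlaw : ∀ i, P.map (X i) = π) (hπ : QuasiUniform c C π) {c₀ : ℝ} {m : Fin d → ℝ → ℝ}
    {l : NNReal} (hm : ∀ α, LipschitzOnWith l (m α) (Set.Icc 0 1)) {k : ℝ → ℝ} {M : ℝ}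
    (hk0 : ∀ u, 0 ≤ k u) (hkM : ∀ u, k u ≤ M) (hks : ∀ u, 1 < |u| → k u = 0)
    (hh : BandwidthOrder h) (hN : KnotOrder N) {μ : Fin d → Measure ℝ}
    (hμ : ∀ α, μ α = π.map fun x => x α) {a : (n : ℕ) → Ω → SplineCoeff d (N n)}
    (ha : ∀ n ω, IsLeastSquares μ n (X · ω) (fun i => additiveMean c₀ m (X i ω)) (a n ω))
    {β : Fin d} (hβ : β ≠ 0) (hcenter : ∫ y, m β (y β) ∂π = 0) :
    IsBigOp P
      (fun n ω => ⨆ t : Set.Icc (0 : ℝ) 1, |biasPart k (h n) m μ n (X · ω) (a n ω) β t|)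
      (fun n => (n : ℝ) ^ (-(1 / 2) : ℝ) + mesh (N n)) := by
  intro ε hε
  have : IsProbabilityMeasure π := hlaw 0 ▸ Measure.isProbabilityMeasure_map (hX 0).aemeasurable
  set V := 2 * mixConst K r (1 / 10) / ε
  have hB := biasConst_nonneg d l c M hπ.upper_pos.le
  refine ⟨biasConst d l c C M * (1 + √V) + 1, by positivity, ?_⟩
  filter_upwards [hdec.eventually_measure_not_regularSample_le hX hlaw hπ hh hN β hε,
    hh.eventually_pos, eventually_gridIdx_le hN hh, eventually_gt_atTop 0]
    with n hirregular hhn hwindow hn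
  have hH := (mesh_pos (N n)).le
  refine hirregular.trans' (measure_mono fun ω hω hreg => ?_)
  rw [Set.mem_ofPred_eq] at hω
  refine hω.not_ge ?_
  rw [abs_of_nonneg (Real.iSup_nonneg fun _ => abs_nonneg _)]
  refine Real.iSup_le (fun t => (hreg.abs_biasPart_le hπ hμ hn hm hcenter (ha n ω) hβ hk0 hkM hks
    hhn hwindow t.2).trans ?_) (by positivity)
  have hsqrt : √(V / n) = √V * (n : ℝ) ^ (-(1 / 2) : ℝ) := by
    rw [Real.sqrt_div' _ n.cast_nonneg, Real.rpow_neg n.cast_nonneg, ← Real.sqrt_eq_rpow,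
      div_eq_mul_inv]
  rw [hsqrt]
  have hrest : 0 ≤ biasConst d l c C M * ((n : ℝ) ^ (-(1 / 2) : ℝ) + √V * mesh (N n)) +
      ((n : ℝ) ^ (-(1 / 2) : ℝ) + mesh (N n)) := by positivity
  linarith

end Irregular

theorem IsBigOp.isLittleOp {Ω : Type*} [MeasurableSpace Ω] {P : Measure Ω} {W : ℕ → Ω → ℝ}
    {r s : ℕ → ℝ} (hW : IsBigOp P W r) (hs : ∀ᶠ n in atTop, 0 < s n)
    (hrs : Tendsto (fun n => r n / s n) atTop (𝓝 0)) : IsLittleOp P W s := by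
  intro δ hδ
  rw [ENNReal.tendsto_nhds_zero]
  intro ε hε
  obtain ⟨ε', hε', hle⟩ : ∃ ε' : ℝ, 0 < ε' ∧ ENNReal.ofReal ε' ≤ ε := by
    rcases eq_or_ne ε ⊤ with rfl | htop
    · exact ⟨1, one_pos, le_top⟩
    · exact ⟨ε.toReal, ENNReal.toReal_pos hε.ne' htop, (ENNReal.ofReal_toReal htop).le⟩
  obtain ⟨M, hM, hev⟩ := hW ε' hε'
  filter_upwards [hev, hs, hrs.eventually_lt_const (by positivity : 0 < δ / M)]
    with n hbound hsn hratio
  have hscale : M * r n < δ * s n := by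
    rw [div_lt_div_iff₀ hsn hM] at hratio
    linarith
  exact (measure_mono fun _ hω => hscale.trans hω).trans (hbound.trans hle)

theorem ComponentSmoothness.exists_lipschitzOnWith {d : ℕ} [NeZero d] {m : Fin d → ℝ → ℝ}
    (hm : ComponentSmoothness m) :
    ∃ l : NNReal, ∀ α, LipschitzOnWith l (m α) (Set.Icc 0 1) := by
  obtain ⟨hsmooth, C, hC, hlip⟩ := hm
  obtain ⟨l, hl⟩ := hsmooth.exists_lipschitzOnWith (by norm_num) (convex_Icc 0 1) isCompact_Icc
  refine ⟨max l ⟨C, hC.le⟩, fun α => ?_⟩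
  rcases eq_or_ne α 0 with rfl | hα
  · exact hl.weaken (le_max_left _ _)
  · exact (LipschitzOnWith.of_dist_le_mul (K := ⟨C, hC.le⟩) (hlip α hα)).weaken (le_max_right _ _)

end SPBK

end

theorem proposition4p1_general {Ω : Type*} [MeasurableSpace Ω] (P : Measure Ω)
    [IsProbabilityMeasure P] {d : ℕ} [NeZero d] (X : ℕ → Ω → (Fin d → ℝ))
    (hX : ∀ i, Measurable (X i)) (hlaw : ∀ i, P.map (X i) = P.map (X 0)) (c : ℝ) (m : Fin d → ℝ → ℝ)
    (hlip : ∃ l : NNReal, ∀ α, LipschitzOnWith l (m α) (Set.Icc 0 1))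
    (hdecay : ∃ K₀ r, SPBK.GeometricEventDecay P X K₀ r)
    (hdesign : ∃ c_f C_f, SPBK.QuasiUniform c_f C_f (P.map (X 0)))
    (K : ℝ → ℝ) (hK0 : ∀ u, 0 ≤ K u) (hKbdd : ∃ M, ∀ u, K u ≤ M) (hKsupp : ∀ u, 1 < |u| → K u = 0)
    (h : ℕ → ℝ) (hh : SPBK.BandwidthOrder h) (N : ℕ → ℕ) (hN : SPBK.KnotOrder N)
    (μ : Fin d → Measure ℝ) (hμ : ∀ α, μ α = P.map (fun ω => X 0 ω α))
    (a : (n : ℕ) → Ω → SPBK.SplineCoeff d (N n))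
    (ha : ∀ n ω, SPBK.IsLeastSquares μ n (fun i => X i ω)
      (fun i => SPBK.additiveMean c m (X i ω)) (a n ω))
    (β : Fin d) (hβ : β ≠ 0) (hcenter : ∫ ω, m β (X 0 ω β) ∂P = 0) :
    SPBK.IsBigOp P
      (fun n ω => ⨆ x₁ : Set.Icc (0 : ℝ) 1,
        |SPBK.biasPart K (h n) m μ n (fun i => X i ω) (a n ω) β x₁|)
      (fun n => (n : ℝ) ^ (-(1 / 2) : ℝ) + SPBK.mesh (N n)) ∧
    SPBK.IsLittleOp P
      (fun n ω => ⨆ x₁ : Set.Icc (0 : ℝ) 1,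
        |SPBK.biasPart K (h n) m μ n (fun i => X i ω) (a n ω) β x₁|)
      (fun n => (n : ℝ) ^ (-(2 / 5) : ℝ)) := by
  obtain ⟨l, hl⟩ := hlip
  obtain ⟨K₀, r, hdec⟩ := hdecay
  obtain ⟨c_f, C_f, hπ⟩ := hdesign
  obtain ⟨M, hM⟩ := hKbdd
  have hmarginal : ∀ α, μ α = (P.map (X 0)).map fun x => x α := fun α => by
    rw [hμ, Measure.map_map (measurable_pi_apply α) (hX 0)]
    rfl
  have hcenter' : ∫ y, m β (y β) ∂P.map (X 0) = 0 := by
    rwa [integral_map (hX 0).aemeasurable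
      (SPBK.aestronglyMeasurable_comp_eval hπ.ae_mem_unitCube (hl β) β)]
  have hO := SPBK.isBigOp_iSup_biasPart hX hdec hlaw hπ hl hK0 hM hKsupp hh hN hmarginal ha hβ
    hcenter'
  exact ⟨hO, hO.isLittleOp (SPBK.eventually_natCast_pos.mono fun _ hn => Real.rpow_pos_of_pos hn _)
    hN.tendsto_rate_div⟩

/-- The predictors are `X i`, `i = 0, 1, …`, and the sample of size `n` consists of
`X 0, …, X (n-1)`. The coefficients `a n ω` are those of the noiseless spline fit, that is, any
solution of the least squares problem with responses `m(X_i)`. -/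
theorem proposition4p1 {Ω : Type*} [MeasurableSpace Ω] (P : Measure Ω) [IsProbabilityMeasure P]
    {d : ℕ} [NeZero d]
    (X : ℕ → Ω → (Fin d → ℝ)) (noise : ℕ → Ω → ℝ)
    (hX : ∀ i, Measurable (X i)) (hnoise : ∀ i, Measurable (noise i))
    (c : ℝ) (m : Fin d → ℝ → ℝ)
    (hcenter : ∀ α i, ∫ ω, m α (X i ω α) ∂P = 0)
    (hsmooth : SPBK.ComponentSmoothness m)
    (hmix : SPBK.GeometricallyMixing P (fun i ω => (X i ω, noise i ω)))
    (hdens : SPBK.DesignDensity P X)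
    (K : ℝ → ℝ) (hK : SPBK.KernelCondition K)
    (h : ℕ → ℝ) (hh : SPBK.BandwidthOrder h)
    (N : ℕ → ℕ) (hN : SPBK.KnotOrder N)
    (μ : Fin d → Measure ℝ) (hμ : ∀ α, μ α = P.map (fun ω => X 0 ω α))
    (a : (n : ℕ) → Ω → SPBK.SplineCoeff d (N n))
    (ha : ∀ n ω, SPBK.IsLeastSquares μ n (fun i => X i ω)
      (fun i => SPBK.additiveMean c m (X i ω)) (a n ω))
    (β : Fin d) (hβ : β ≠ 0) :
    SPBK.IsBigOp P
      (fun n ω => ⨆ x₁ : Set.Icc (0 : ℝ) 1,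
        |SPBK.biasPart K (h n) m μ n (fun i => X i ω) (a n ω) β x₁|)
      (fun n => (n : ℝ) ^ (-(1 / 2) : ℝ) + SPBK.mesh (N n)) ∧
    SPBK.IsLittleOp P
      (fun n ω => ⨆ x₁ : Set.Icc (0 : ℝ) 1,
        |SPBK.biasPart K (h n) m μ n (fun i => X i ω) (a n ω) β x₁|)
      (fun n => (n : ℝ) ^ (-(2 / 5) : ℝ)) := by
  obtain ⟨hlaw, hdesign⟩ := hdens.exists_quasiUniform
  exact proposition4p1_general P X hX hlaw c m hsmooth.exists_lipschitzOnWith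
    hmix.geometricEventDecay_fst hdesign K hK.2.2.1 hK.2.1 hK.2.2.2.2 h hh N hN μ hμ a ha β hβ
    (hcenter β 0)
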